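/- Let $\mathbb K$ be $\mathbb R$ or $\mathbb C$ (scaling dimensions are real, or complex when regularized). **Intertwiners.** For $a\in\mathbb K$ let $\pi_a$ be the space of smooth functions $f:\mathbb R\to\mathbb K$ on which the vector fields $v\partial$, $v\in\{1,x,x^2\}$ (spanning $sl(2)$), act by $f\mapsto vf'+(1-a)v'f$. For $m\in\mathbb N_0$ and $c=a+b-1-m$ put $$\lambda_{ab}^c(f,g)=\sum_{p+q=m}(-1)^q\,\frac{(c+b-a)_p}{p!}\,\frac{(c+a-b)_q}{q!}\;\partial^pf\,\partial^qg ,\qquad (x)_k=x(x+1)\cdots(x+k-1).$$ For $\underline a=(a_1,\dots,a_n)$ and $\underline m=(m_1,\dots,m_{n-1})\in\mathbb N_0^{n-1}$ let $$T_{\underline a}^{\underline m}(f_1,\dots,f_n)=\lambda^{e}_{a_1\varepsilon_1}\bigl(f_1,\lambda^{\varepsilon_1}_{a_2\varepsilon_2}(f_2,\dots,\lambda^{\varepsilon_{n-2}}_{a_{n-1}a_n}(f_{n-1},f_n)\cdots)\bigr),$$ where $\varepsilon_i=\sum_{s>i}a_s-\sum_{t>i}m_t-n+i+1$ and $e=e(\underline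 a,\underline m)=\sum_s a_s-\sum_t m_t-n+1$ ($T$ is the identity for $n=1$). When the $T_{\underline a}^{\underline m}$ with $\sum_t m_t=M$ are a basis of the space of support-preserving $sl(2)$-intertwiners $\pi_{a_1}\times\dots\times\pi_{a_n}\to\pi_e$, the matrix $Z_{\underline a,\sigma}$ of a permutation $\sigma\in S_n$ is defined by $$T_{(a_{\sigma1},\dots,a_{\sigma n})}^{\underline{\widetilde m}}(f_{\sigma1},\dots,f_{\sigma n})=\sum_{\underline m}(Z_{\underline a,\sigma})^{\underline{\widetilde m}}_{\underline m}\,T_{\underline a}^{\underline m}(f_1,\dots,f_n),\qquad \textstyle\sum_t\widetilde m_t=\sum_t m_t ,$$ and $Z^\varepsilon_{\underline a,\sigma}=\operatorname{sgn}(\sigma)Z_{\underline a,\sigma}$. Let $Y_{bca}$ be the matrix $Z_{(a,b,c),\sigma}$ of the cyclic permutation: $T_{bca}^{\widetilde m}(g,h,f)=\sum_m (Y_{bca})^{\widetilde m}_mT_{abc}^m(f,g,h)$. **Reduced Lie algebra.** Let $V=\bigoplus_a V_a$ be a $\mathbb K$-vector space graded by scaling dimensions $a\in\mathbb K$, with bilinear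 brackets $\Gamma^*(\cdot,\cdot)_m$, $m\in\mathbb N_0$, such that $\Gamma^*(V_a,V_b)_m\subseteq V_{a+b-1-m}$ and $\Gamma^*(A,B)_m=(-1)^{m+1}\Gamma^*(B,A)_m$ (in a homogeneous basis, $\Gamma^*(A,B)_m=\sum_C F_{AB}^C\,C$ with structure constants $F_{AB}^C$), satisfying the reduced Jacobi identity: for $A\in V_a,B\in V_b,C\in V_c$ and all $m=(m_1,m_2)$, $$\Gamma^*(A,\Gamma^*(B,C))_{m}+\sum_{\widetilde m}\Gamma^*(B,\Gamma^*(C,A))_{\widetilde m}(Y_{bca})^{\widetilde m}_{m}+\sum_{\widehat m,\widetilde m}\Gamma^*(C,\Gamma^*(A,B))_{\widehat m}(Y_{cab})^{\widehat m}_{\widetilde m}(Y_{bca})^{\widetilde m}_{m}=0,$$ where $\Gamma^*(A,\Gamma^*(B,C))_{m_1m_2}=\Gamma^*(A,\Gamma^*(B,C)_{m_2})_{m_1}$. Assume that the matrices involved are well defined: for all $n\ge2$, all $a_1,\dots,a_n$ with $V_{a_i}\ne0$ and all $M\in\mathbb N_0$ with $V_e\neq0$, $e=\sum_s a_s-M-n+1$,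 the $T^{\underline m}_{\underline a}$ with $\sum_t m_t=M$ are a basis of the local intertwiners $\pi_{a_1}\times\dots\times\pi_{a_n}\to\pi_e$. **Complex.** $C^n(V)$ is the space of families of multilinear maps $\omega(X_1,\dots,X_n)_{\underline m}\in V_{e(\underline a,\underline m)}$, $X_i\in V_{a_i}$, $\underline m\in\mathbb N_0^{n-1}$, that are $Z^\varepsilon$-symmetric: for every $\sigma\in S_n$, $$\omega(X_1,\dots,X_n)_{\underline m}=\sum_{\underline{\widetilde m}}\omega(X_{\sigma1},\dots,X_{\sigma n})_{\underline{\widetilde m}}\,(Z^\varepsilon_{\underline a,\sigma})^{\underline{\widetilde m}}_{\underline m};$$ $C^0(V)=V_1$. The coboundary operators are, for $n\ge1$, $$[b^n\omega](X_1,\dots,X_{n+1})_{\underline m}=\frac{(-1)^n}{n!}\sum_{\sigma\in S_{n+1}}\sum_{\underline{\widetilde m}}\Gamma^*\bigl(X_{\sigma1},\omega(X_{\sigma2},\dots,X_{\sigma(n+1)})_{\widetilde m_2\dots\widetilde m_n}\bigr)_{\widetilde m_1}(Z^\varepsilon_{\underline a,\sigma})^{\underline{\widetilde m}}_{\underline m}$$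 $$\qquad+\frac1{2(n-1)!}\sum_{\sigma\in S_{n+1}}\sum_{\underline{\widetilde m}}\omega\bigl(X_{\sigma1},\dots,X_{\sigma(n-1)},\Gamma^*(X_{\sigma n},X_{\sigma(n+1)})_{\widetilde m_n}\bigr)_{\widetilde m_1\dots\widetilde m_{n-1}}(Z^\varepsilon_{\underline a,\sigma})^{\underline{\widetilde m}}_{\underline m},$$ and $[b^0\omega](X)=\Gamma^*(X,\omega)_0$. **Proposition.** For every $n\ge0$, $b^n$ maps $C^n(V)$ into $C^{n+1}(V)$ and $b^{n+1}\circ b^n=0$ on $C^n(V)$. Consequently, with $Z^n(V)=\ker(b^n|_{C^n(V)})$, $B^n(V)=b^{n-1}(C^{n-1}(V))$ and $B^0(V)=0$, one has $B^n(V)\subseteq Z^n(V)$, and the reduced Lie algebra cohomology $RLH^n(V)=Z^n(V)/B^n(V)$ is well defined. -/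

import Mathlib

noncomputable section

namespace RedLie

section Intertwiners

variable (𝕜 : Type*) [RCLike 𝕜]

/-- Smooth test functions on the real line, as a subalgebra of `ℝ → 𝕜`. -/
def Smooth : Subalgebra 𝕜 (ℝ → 𝕜) where
  carrier := {f | ContDiff ℝ (⊤ : ℕ∞) f}
  mul_mem' {f g} (hf : ContDiff ℝ (⊤ : ℕ∞) f) (hg : ContDiff ℝ (⊤ : ℕ∞) g) := hf.mul hg
  add_mem' {f g} (hf : ContDiff ℝ (⊤ : ℕ∞) f) (hg : ContDiff ℝ (⊤ : ℕ∞) g) := hf.add hg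
  algebraMap_mem' r := (contDiff_const : ContDiff ℝ (⊤ : ℕ∞) fun _ : ℝ => r)

variable {𝕜}

theorem smooth_contDiff (f : Smooth 𝕜) : ContDiff ℝ (⊤ : ℕ∞) (f : ℝ → 𝕜) := f.2

theorem smooth_differentiable (f : Smooth 𝕜) : Differentiable ℝ (f : ℝ → 𝕜) :=
  (smooth_contDiff f).differentiable (by simp)

variable (𝕜)

/-- The derivative `∂` on test functions. -/
def D : Smooth 𝕜 →ₗ[𝕜] Smooth 𝕜 where
  toFun f := ⟨deriv (f : ℝ → 𝕜), (contDiff_infty_iff_deriv.1 (smooth_contDiff f)).2⟩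
  map_add' f g := by
    ext x
    exact deriv_add (smooth_differentiable f x) (smooth_differentiable g x)
  map_smul' c f := by
    ext x
    exact deriv_const_smul c (smooth_differentiable f x)

/-- The test function `x ↦ x`. -/
def X : Smooth 𝕜 :=
  ⟨fun x => (x : 𝕜), show ContDiff ℝ (⊤ : ℕ∞) _ from (RCLike.ofRealCLM (K := 𝕜)).contDiff⟩

variable {𝕜}

/-- The action on test functions of `π_a` of the vector field `v ∂`, namely
`f ↦ v f' + (1 - a) v' f`. For `v = 1, x, x²` these are (up to the scalar `i`) the generators
`p, d, k` of `sl(2)`. -/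
def act (a : 𝕜) (v f : Smooth 𝕜) : Smooth 𝕜 :=
  v * D 𝕜 f + (1 - a) • (D 𝕜 v * f)

theorem act_add (a : 𝕜) (v f g : Smooth 𝕜) : act a v (f + g) = act a v f + act a v g := by
  simp only [act, map_add, mul_add, smul_add]
  abel

theorem act_smul (a c : 𝕜) (v f : Smooth 𝕜) : act a v (c • f) = c • act a v f := by
  simp only [act, map_smul, mul_smul_comm, smul_add]
  rw [smul_comm]

/-- `λ_{ab}^c(p,q) = (-1)^q (c+b-a)_p / p! · (c+a-b)_q / q!`, with `(x)_n` the rising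
Pochhammer symbol. -/
def lamCoeff (a b c : 𝕜) (p q : ℕ) : 𝕜 :=
  (-1) ^ q * ((ascPochhammer 𝕜 p).eval (c + b - a) / (p.factorial : 𝕜)) *
    ((ascPochhammer 𝕜 q).eval (c + a - b) / (q.factorial : 𝕜))

/-- The local intertwiner `λ_{ab}^c`, indexed by `m = a + b - c - 1 ∈ ℕ`. -/
def lam (a b : 𝕜) (m : ℕ) : Smooth 𝕜 →ₗ[𝕜] Smooth 𝕜 →ₗ[𝕜] Smooth 𝕜 :=
  ∑ pq ∈ Finset.HasAntidiagonal.antidiagonal m, lamCoeff a b (a + b - 1 - m) pq.1 pq.2 •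
    (LinearMap.mul 𝕜 (Smooth 𝕜)).compl₁₂ (D 𝕜 ^ pq.1) (D 𝕜 ^ pq.2)

/-- The dimension `e = ∑ a_s - ∑ m_t - n + 1` of the final representation. -/
def outDim {n : ℕ} (a : Fin n → 𝕜) (m : Fin (n - 1) → ℕ) : 𝕜 :=
  ∑ i, a i - ∑ i, (m i : 𝕜) - n + 1

/-- The default nested operators
`T_a^m = λ_{a_1 ε_1} ∘ (1 × λ_{a_2 ε_2} ∘ (1 × 1 × ⋯ λ_{a_{n-1} a_n}))`.
It is the identity for `n = 1` and the constant function `1` for `n = 0`. -/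
def defaultT : ∀ (n : ℕ) (_ : Fin n → 𝕜) (_ : Fin (n - 1) → ℕ),
    MultilinearMap 𝕜 (fun _ : Fin n => Smooth 𝕜) (Smooth 𝕜)
  | 0, _, _ => MultilinearMap.constOfIsEmpty 𝕜 _ 1
  | 1, _, _ => MultilinearMap.ofSubsingleton 𝕜 (Smooth 𝕜) (Smooth 𝕜) (0 : Fin 1) LinearMap.id
  | k + 2, a, m =>
    LinearMap.uncurryLeft
      { toFun := fun f =>
          (lam (a 0) (outDim (n := k + 1) (Fin.tail a) (Fin.tail (n := k) m)) (m (0 : Fin (k + 1)))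
            f).compMultilinearMap (defaultT (k + 1) (Fin.tail a) (Fin.tail (n := k) m))
        map_add' := fun f g => by ext; simp
        map_smul' := fun c f => by ext; simp }

/-- The space of local (support preserving) `sl(2)`-intertwiners
`π_{a_1} × ⋯ × π_{a_n} → π_e`. -/
def localIntertwiners {n : ℕ} (a : Fin n → 𝕜) (e : 𝕜) :
    Submodule 𝕜 (MultilinearMap 𝕜 (fun _ : Fin n => Smooth 𝕜) (Smooth 𝕜)) where
  carrier := {T |
    (∀ (f : Fin n → Smooth 𝕜) (i : Fin n) (x : ℝ),
      x ∉ tsupport (f i : ℝ → 𝕜) → (T f : ℝ → 𝕜) x = 0) ∧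
    ∀ v ∈ ({1, X 𝕜, X 𝕜 ^ 2} : Set (Smooth 𝕜)), ∀ f : Fin n → Smooth 𝕜,
      ∑ i, T (Function.update f i (act (a i) v (f i))) = act e v (T f)}
  add_mem' := by
    rintro S T ⟨hS, hS'⟩ ⟨hT, hT'⟩
    refine ⟨fun f i x hx => ?_, fun v hv f => ?_⟩
    · simp [hS f i x hx, hT f i x hx]
    · simp only [add_apply, Finset.sum_add_distrib, hS' v hv f, hT' v hv f, act_add]
  zero_mem' := by
    refine ⟨fun f i x _ => by simp, fun v _ f => by simp [act]⟩
  smul_mem' := by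
    rintro c T ⟨hT, hT'⟩
    refine ⟨fun f i x hx => by simp [hT f i x hx], fun v hv f => ?_⟩
    simp only [smul_apply, ← Finset.smul_sum, hT' v hv f, act_smul]

/-- The multi-indices `m ∈ ℕ^k` with `∑ m_i = M`. -/
abbrev multiIdx (k M : ℕ) : Finset (Fin k → ℕ) := Finset.piAntidiag Finset.univ M

/-- The operators `T_a^m` with `∑ m_i = M` form a basis of the space of local intertwiners
`π_{a_1} × ⋯ × π_{a_n} → π_e`, where `e = ∑ a_s - M - n + 1`. -/
def IsDefaultBasis {n : ℕ} (a : Fin n → 𝕜) (M : ℕ) : Prop :=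
  LinearIndependent 𝕜 (fun m : multiIdx (n - 1) M => defaultT n a m) ∧
    Submodule.span 𝕜 (Set.range fun m : multiIdx (n - 1) M => defaultT n a m) =
      localIntertwiners a (∑ i, a i - M - n + 1)

open Classical in
/-- The matrix element `(Z_{a,σ})^{m'}_m`, defined by
`T_{σ(a)}^{m'}(f_{σ 1}, …, f_{σ n}) = ∑_m (Z_{a,σ})^{m'}_m T_a^m(f_1, …, f_n)`; the sum is over
the `m` with `∑ m_i = ∑ m'_i`, and all other matrix elements vanish. -/
def Z {n : ℕ} (a : Fin n → 𝕜) (σ : Equiv.Perm (Fin n)) (m' m : Fin (n - 1) → ℕ) : 𝕜 :=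
  if h : ∃ z : (Fin (n - 1) → ℕ) → 𝕜, (∀ m, ∑ i, m i ≠ ∑ i, m' i → z m = 0) ∧
      ∀ f : Fin n → Smooth 𝕜, defaultT n (a ∘ σ) m' (f ∘ σ) =
        ∑ m ∈ multiIdx (n - 1) (∑ i, m' i), z m • defaultT n a m f
  then h.choose m else 0

/-- The signed matrix `Z^ε = ε_σ Z`. -/
def Zeps {n : ℕ} (a : Fin n → 𝕜) (σ : Equiv.Perm (Fin n)) (m' m : Fin (n - 1) → ℕ) : 𝕜 :=
  ((Equiv.Perm.sign σ : ℤ) : 𝕜) * Z a σ m' m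

/-- The matrix describing the cyclic permutation
`T_{bca}^{m'}(g, h, f) = ∑_m Y^{m'}_m T_{abc}^m(f, g, h)`, where `d = (a, b, c)`. -/
def Y (d : Fin 3 → 𝕜) (m' m : Fin 2 → ℕ) : 𝕜 := Z d (finRotate 3) m' m

end Intertwiners

/-- A reduced Lie algebra: a graded space `V = ⨁ V_a` with a multi-component bracket
`Γ_m : V_a × V_b → V_{a+b-1-m}`, graded symmetric and satisfying the reduced Jacobi identity. -/
structure ReducedLieAlgebra (𝕜 : Type*) [RCLike 𝕜] (V : Type*) [AddCommGroup V] [Module 𝕜 V] where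
  gr : 𝕜 → Submodule 𝕜 V
  isInternal : open Classical in DirectSum.IsInternal gr
  Γ : ℕ → V →ₗ[𝕜] V →ₗ[𝕜] V
  Γ_mem : ∀ (m : ℕ) (a b : 𝕜), ∀ A ∈ gr a, ∀ B ∈ gr b, Γ m A B ∈ gr (a + b - 1 - m)
  Γ_symm : ∀ (m : ℕ) (A B : V), Γ m A B = (-1 : 𝕜) ^ (m + 1) • Γ m B A
  jacobi : ∀ (a b c : 𝕜), ∀ A ∈ gr a, ∀ B ∈ gr b, ∀ C ∈ gr c, ∀ m : Fin 2 → ℕ,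
    Γ (m 0) A (Γ (m 1) B C) +
      ∑ m' ∈ multiIdx 2 (∑ i, m i), Y ![a, b, c] m' m • Γ (m' 0) B (Γ (m' 1) C A) +
      ∑ m'' ∈ multiIdx 2 (∑ i, m i),
        (∑ m' ∈ multiIdx 2 (∑ i, m i), Y ![b, c, a] m'' m' * Y ![a, b, c] m' m) •
          Γ (m'' 0) C (Γ (m'' 1) A B) = 0

namespace ReducedLieAlgebra

variable {𝕜 : Type*} [RCLike 𝕜] {V : Type*} [AddCommGroup V] [Module 𝕜 V]
  (L : ReducedLieAlgebra 𝕜 V)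

/-- The intertwiner bases needed for `V` are nondegenerate: for all scaling dimensions
`a_1, …, a_n, e` that occur in `V`, the default operators are a basis of the space of local
intertwiners `π_{a_1} × ⋯ × π_{a_n} → π_e`. -/
def HasDefaultBases : Prop :=
  ∀ (n : ℕ) (a : Fin n → 𝕜) (M : ℕ), 2 ≤ n → (∀ i, L.gr (a i) ≠ ⊥) →
    L.gr (∑ i, a i - M - n + 1) ≠ ⊥ → IsDefaultBasis a M

/-- Multi-component functions `w(X_1, …, X_n)_m` of homogeneous arguments `X_i ∈ V_{a_i}`. -/
abbrev Family (n : ℕ) : Type _ :=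
  (a : Fin n → 𝕜) → (Fin (n - 1) → ℕ) → ((i : Fin n) → L.gr (a i)) → V

/-- The space `C^n(V)` of `n`-cochains: multilinear multi-component maps with
`w(X_1, …, X_n)_m ∈ V_e`, `e = ∑ a_s - ∑ m_t - n + 1`, that are `Z^ε`-symmetric. -/
def C (n : ℕ) : Submodule 𝕜 (L.Family n) where
  carrier := {w |
    (∀ a m, ∃ φ : MultilinearMap 𝕜 (fun i : Fin n => L.gr (a i)) V, ⇑φ = w a m) ∧
    (∀ a m x, w a m x ∈ L.gr (outDim a m)) ∧
    ∀ (a : Fin n → 𝕜) (m : Fin (n - 1) → ℕ) (x : (i : Fin n) → L.gr (a i))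
      (σ : Equiv.Perm (Fin n)),
      w a m x = ∑ m' ∈ multiIdx (n - 1) (∑ i, m i),
        Zeps a σ m' m • w (a ∘ σ) m' (fun i => x (σ i))}
  add_mem' := by
    rintro w η ⟨h1, h2, h3⟩ ⟨k1, k2, k3⟩
    refine ⟨fun a m => ?_, fun a m x => add_mem (h2 a m x) (k2 a m x), fun a m x σ => ?_⟩
    · obtain ⟨φ, hφ⟩ := h1 a m
      obtain ⟨ψ, hψ⟩ := k1 a m
      exact ⟨φ + ψ, by rw [FunLike.coe_add, hφ, hψ]; rfl⟩
    · simp only [Pi.add_apply, smul_add, Finset.sum_add_distrib, ← h3 a m x σ, ← k3 a m x σ]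
  zero_mem' := ⟨fun _ _ => ⟨0, rfl⟩, fun _ _ _ => zero_mem _, fun a m x σ => by simp⟩
  smul_mem' := by
    rintro c w ⟨h1, h2, h3⟩
    refine ⟨fun a m => ?_, fun a m x => Submodule.smul_mem _ c (h2 a m x), fun a m x σ => ?_⟩
    · obtain ⟨φ, hφ⟩ := h1 a m
      exact ⟨c • φ, by rw [FunLike.coe_smul, hφ]; rfl⟩
    · simp only [Pi.smul_apply, smul_comm _ c, ← Finset.smul_sum, ← h3 a m x σ]

/-- `[Γ(X_1, w(X_2, …, X_{n+1}))]_{m_1 … m_n}`, where `n = k + 1`. -/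
def outerTerm {k : ℕ} (w : L.Family (k + 1)) (a : Fin (k + 2) → 𝕜) (m : Fin (k + 1) → ℕ)
    (x : (i : Fin (k + 2)) → L.gr (a i)) : V :=
  L.Γ (m 0) (x 0) (w (Fin.tail a) (Fin.tail m) (fun i => x i.succ))

/-- The dimensions `(a_1, …, a_{n-1}, a_n + a_{n+1} - 1 - r)`, where `n = k + 1`. -/
def mergeDim {k : ℕ} (a : Fin (k + 2) → 𝕜) (r : ℕ) : Fin (k + 1) → 𝕜 :=
  Fin.snoc (α := fun _ => 𝕜) (fun i : Fin k => a i.castSucc.castSucc)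
    (a (Fin.last k).castSucc + a (Fin.last (k + 1)) - 1 - r)

/-- The arguments `(X_1, …, X_{n-1}, Γ(X_n, X_{n+1})_r)`, where `n = k + 1`. -/
def mergeArg {k : ℕ} (a : Fin (k + 2) → 𝕜) (r : ℕ) (x : (i : Fin (k + 2)) → L.gr (a i))
    (i : Fin (k + 1)) : L.gr (mergeDim a r i) :=
  ⟨Fin.snoc (α := fun _ => V) (fun i : Fin k => (x i.castSucc.castSucc : V))
    (L.Γ r (x (Fin.last k).castSucc) (x (Fin.last (k + 1)))) i, by
    refine Fin.lastCases ?_ (fun j => ?_) i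
    · simpa [mergeDim] using L.Γ_mem r _ _ _ (x _).2 _ (x _).2
    · simp [mergeDim]⟩

/-- `[w(X_1, …, X_{n-1}, Γ(X_n, X_{n+1}))]_{m_1 … m_n}`, where `n = k + 1`. -/
def innerTerm {k : ℕ} (w : L.Family (k + 1)) (a : Fin (k + 2) → 𝕜) (m : Fin (k + 1) → ℕ)
    (x : (i : Fin (k + 2)) → L.gr (a i)) : V :=
  w (mergeDim a (m (Fin.last k))) (Fin.init m) (L.mergeArg a (m (Fin.last k)) x)

theorem outerTerm_add {k : ℕ} (w η : L.Family (k + 1)) (a : Fin (k + 2) → 𝕜)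
    (m : Fin (k + 1) → ℕ) (x : (i : Fin (k + 2)) → L.gr (a i)) :
    L.outerTerm (w + η) a m x = L.outerTerm w a m x + L.outerTerm η a m x :=
  map_add (L.Γ (m 0) (x 0)) _ _

theorem outerTerm_smul {k : ℕ} (c : 𝕜) (w : L.Family (k + 1)) (a : Fin (k + 2) → 𝕜)
    (m : Fin (k + 1) → ℕ) (x : (i : Fin (k + 2)) → L.gr (a i)) :
    L.outerTerm (c • w) a m x = c • L.outerTerm w a m x :=
  map_smul (L.Γ (m 0) (x 0)) _ _

theorem innerTerm_add {k : ℕ} (w η : L.Family (k + 1)) (a : Fin (k + 2) → 𝕜)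
    (m : Fin (k + 1) → ℕ) (x : (i : Fin (k + 2)) → L.gr (a i)) :
    L.innerTerm (w + η) a m x = L.innerTerm w a m x + L.innerTerm η a m x := rfl

theorem innerTerm_smul {k : ℕ} (c : 𝕜) (w : L.Family (k + 1)) (a : Fin (k + 2) → 𝕜)
    (m : Fin (k + 1) → ℕ) (x : (i : Fin (k + 2)) → L.gr (a i)) :
    L.innerTerm (c • w) a m x = c • L.innerTerm w a m x := rfl

/-- The coboundary operator `b^n` for `n = k + 1`. -/
def bSucc (k : ℕ) (w : L.Family (k + 1)) : L.Family (k + 2) := fun a m x =>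
  ((-1 : 𝕜) ^ (k + 1) / ((k + 1).factorial : 𝕜)) •
      ∑ σ : Equiv.Perm (Fin (k + 2)), ∑ m' ∈ multiIdx (k + 1) (∑ i, m i),
        Zeps a σ m' m • L.outerTerm w (a ∘ σ) m' (fun i => x (σ i)) +
    (1 / (2 * (k.factorial : 𝕜))) •
      ∑ σ : Equiv.Perm (Fin (k + 2)), ∑ m' ∈ multiIdx (k + 1) (∑ i, m i),
        Zeps a σ m' m • L.innerTerm w (a ∘ σ) m' (fun i => x (σ i))

/-- The coboundary operator `b^n`. A `0`-cochain is an element `w` of `V_1` (no arguments, and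
`e = 1`), and `(b^0 w)(X) = Γ(X, w)_0`, the only component of `Γ(X, w)` in the space of `X`. -/
def b : ∀ n : ℕ, L.Family n →ₗ[𝕜] L.Family (n + 1)
  | 0 =>
    { toFun := fun w a _ x => L.Γ 0 (x 0) (w Fin.elim0 Fin.elim0 (fun i => i.elim0))
      map_add' := fun w η => by ext a m x; simp
      map_smul' := fun c w => by ext a m x; simp }
  | k + 1 =>
    { toFun := L.bSucc k
      map_add' := fun w η => by
        ext a m x
        simp only [bSucc, outerTerm_add, innerTerm_add, Pi.add_apply, smul_add,
          Finset.sum_add_distrib]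
        exact add_add_add_comm _ _ _ _
      map_smul' := fun c w => by
        ext a m x
        simp only [bSucc, outerTerm_smul, innerTerm_smul, Pi.smul_apply, smul_comm _ c,
          ← Finset.smul_sum, smul_add, RingHom.id_apply] }

/-- The cocycles `Z^n(V) = Ker b^n ⊆ C^n(V)`. -/
def cocycles (n : ℕ) : Submodule 𝕜 (L.Family n) := L.C n ⊓ LinearMap.ker (L.b n)

/-- The coboundaries `B^n(V) = {b^{n-1} η | η ∈ C^{n-1}(V)}`, with `B^0(V) = 0`. -/
def coboundaries : ∀ n : ℕ, Submodule 𝕜 (L.Family n)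
  | 0 => ⊥
  | n + 1 => (L.C n).map (L.b n)

/-- The reduced Lie algebra cohomology `RLH^n(V) = Z^n(V) / B^n(V)`. -/
abbrev RLH (n : ℕ) : Type _ := L.cocycles n ⧸ (L.coboundaries n).submoduleOf (L.cocycles n)

/-- The class in `RLH^n(V)` of a cocycle. -/
def RLH.mk (n : ℕ) : L.cocycles n →ₗ[𝕜] L.RLH n :=
  ((L.coboundaries n).submoduleOf (L.cocycles n)).mkQ

end ReducedLieAlgebra

end RedLie

end

/-! Smearing with test functions turns the reduced complex into a Chevalley–Eilenberg complex. For
$x=A\otimes f$ and $y=B\otimes g$ with $A\in V_a$, $B\in V_b$ put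
$[x,y]=\sum_r\Gamma^*(A,B)_r\otimes\lambda_{ab}(f,g)_r$, where $r$ is the index of $\lambda$. Since
$\lambda_{ba}(g,f)_r=(-1)^r\lambda_{ab}(f,g)_r$, the symmetry of $\Gamma^*$ makes this bracket
antisymmetric. Expanding $T_{bca}$ and $T_{cab}$ in $T_{abc}$ by the matrices $Y$ turns the reduced
Jacobi identity into the ordinary one (`jacobi_tensor`).

A family $\omega$ is smeared to $\sum_m\omega(X)_m\otimes T_a^m(f)$. By the definition of $Z$, the
action of $\sigma$ by $Z^\varepsilon$ becomes the signed permutation of smeared arguments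
(`smear_permFamily`), so $Z^\varepsilon$-symmetry becomes antisymmetry. The nesting of $T$ can be
opened from the outside or from the inside; hence the two kinds of terms in $b^n$ become
$[x,\omega(\dots)]$ and $\omega(\dots,[x,y])$ (`smear_outerTerm`, `smear_innerTerm`), and $b^n$
becomes the Chevalley–Eilenberg differential with values in the adjoint representation.

Linear independence of the $T_a^m$ makes smearing injective on graded multilinear families
(`eq_zero_of_smear_eq_zero`). Antisymmetry of the differential and $d^2=0$ therefore descend to
$b^n$.

The bracket is an infinite sum over $r$. To stay with finite sums, smeared values are indexed by the
total index $M$ and the dimension $e$: the $r$-th term carries a shift of $M$ by $r$, and everything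
is cut off at $M<N$ with $N$ arbitrary. The identity $d^2=0$ is proved once for such data
(`FormalAction.diff_diff`), with the Jacobi identity and antisymmetry as hypotheses. -/

noncomputable section

namespace RedLie

/-! ### Signed permutations of the arguments of a function -/

section Antisymmetrization

variable (𝕜 : Type*) [Field 𝕜] {P H : Type*} [AddCommGroup H] [Module 𝕜 H] {n : ℕ}

/-- The sign of a permutation as a scalar. -/
def sgn (σ : Equiv.Perm (Fin n)) : 𝕜 := ((Equiv.Perm.sign σ : ℤ) : 𝕜)

theorem sgn_mul (σ τ : Equiv.Perm (Fin n)) : sgn 𝕜 (σ * τ) = sgn 𝕜 σ * sgn 𝕜 τ := by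
  simp [sgn]

theorem sgn_one : sgn 𝕜 (1 : Equiv.Perm (Fin n)) = 1 := by simp [sgn]

theorem sgn_mul_self (σ : Equiv.Perm (Fin n)) : sgn 𝕜 σ * sgn 𝕜 σ = 1 := by
  rcases Int.units_eq_one_or (Equiv.Perm.sign σ) with h | h <;> simp [sgn, h]

theorem sgn_swap {i j : Fin n} (h : i ≠ j) : sgn 𝕜 (Equiv.swap i j) = -1 := by
  simp [sgn, Equiv.Perm.sign_swap h]

theorem zero_ne_two : (0 : Fin (n + 3)) ≠ 2 := (Fin.succ_ne_zero (1 : Fin (n + 2))).symm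

theorem one_ne_two : (1 : Fin (n + 3)) ≠ 2 := (Fin.succ_succ_ne_one (0 : Fin (n + 1))).symm

theorem sgn_swap_mul_swap : sgn 𝕜 (Equiv.swap (0 : Fin (n + 3)) 1 * Equiv.swap 0 2) = 1 := by
  rw [sgn_mul, sgn_swap _ (by simp), sgn_swap _ zero_ne_two]; simp

theorem sgn_swap_mul_swap' : sgn 𝕜 (Equiv.swap (0 : Fin (n + 3)) 2 * Equiv.swap 0 1) = 1 := by
  rw [sgn_mul, mul_comm, ← sgn_mul, sgn_swap_mul_swap]

/-- Permutation of the arguments of a function of `n` arguments. -/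
def permute (σ : Equiv.Perm (Fin n)) : ((Fin n → P) → H) →ₗ[𝕜] ((Fin n → P) → H) where
  toFun g x := g (x ∘ σ)
  map_add' _ _ := rfl
  map_smul' _ _ := rfl

variable {𝕜}

theorem permute_apply (σ : Equiv.Perm (Fin n)) (g : (Fin n → P) → H) (x : Fin n → P) :
    permute 𝕜 σ g x = g (x ∘ σ) := rfl

theorem permute_permute (σ τ : Equiv.Perm (Fin n)) (g : (Fin n → P) → H) :
    permute 𝕜 σ (permute 𝕜 τ g) = permute 𝕜 (σ * τ) g := rfl

variable (𝕜)

/-- The unnormalized antisymmetrization. -/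
def antisymm : ((Fin n → P) → H) →ₗ[𝕜] ((Fin n → P) → H) :=
  ∑ σ : Equiv.Perm (Fin n), sgn 𝕜 σ • permute 𝕜 σ

/-- Antisymmetry of a function of `n` arguments. -/
def IsAntisymm (g : (Fin n → P) → H) : Prop :=
  ∀ σ : Equiv.Perm (Fin n), permute 𝕜 σ g = sgn 𝕜 σ • g

variable {𝕜}

theorem antisymm_eq (g : (Fin n → P) → H) :
    antisymm 𝕜 g = ∑ σ : Equiv.Perm (Fin n), sgn 𝕜 σ • permute 𝕜 σ g := by
  simp [antisymm]

theorem antisymm_permute (σ : Equiv.Perm (Fin n)) (g : (Fin n → P) → H) :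
    antisymm 𝕜 (permute 𝕜 σ g) = sgn 𝕜 σ • antisymm 𝕜 g := by
  rw [antisymm_eq, antisymm_eq, Finset.smul_sum,
    ← Equiv.sum_comp (Equiv.mulRight σ) fun τ => sgn 𝕜 σ • sgn 𝕜 τ • permute 𝕜 τ g]
  refine Finset.sum_congr rfl fun τ _ => ?_
  rw [Equiv.coe_mulRight, permute_permute, smul_smul, sgn_mul, mul_comm (sgn 𝕜 τ), ← mul_assoc,
    sgn_mul_self, one_mul]

theorem isAntisymm_antisymm (g : (Fin n → P) → H) : IsAntisymm 𝕜 (antisymm 𝕜 g) := by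
  intro σ
  rw [antisymm_eq, map_sum, Finset.smul_sum,
    ← Equiv.sum_comp (Equiv.mulLeft σ) fun τ => sgn 𝕜 σ • sgn 𝕜 τ • permute 𝕜 τ g]
  refine Finset.sum_congr rfl fun τ _ => ?_
  rw [map_smul, permute_permute, smul_smul, Equiv.coe_mulLeft, sgn_mul, ← mul_assoc,
    sgn_mul_self, one_mul]

theorem IsAntisymm.add {g h : (Fin n → P) → H} (hg : IsAntisymm 𝕜 g) (hh : IsAntisymm 𝕜 h) :
    IsAntisymm 𝕜 (g + h) := fun σ => by rw [map_add, hg, hh, smul_add]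

theorem IsAntisymm.smul {g : (Fin n → P) → H} (hg : IsAntisymm 𝕜 g) (c : 𝕜) :
    IsAntisymm 𝕜 (c • g) := fun σ => by rw [map_smul, hg, smul_comm]

/-- An even permutation of the arguments leaves the antisymmetrization unchanged, while here it also
reverses its sign. -/
theorem antisymm_eq_zero_of_permute_eq_neg [CharZero 𝕜] {g : (Fin n → P) → H}
    {ρ : Equiv.Perm (Fin n)} (hρ : sgn 𝕜 ρ = 1) (h : permute 𝕜 ρ g = -g) :
    antisymm 𝕜 g = 0 := by
  have h1 := antisymm_permute (𝕜 := 𝕜) ρ g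
  rw [h, hρ, one_smul, map_neg] at h1
  have h2 : (2 : 𝕜) • antisymm 𝕜 g = 0 := by
    rw [two_smul]; nth_rewrite 1 [← h1]; simp
  exact (smul_eq_zero.1 h2).resolve_left two_ne_zero

/-- The permutation of `Fin (n + 1)` that fixes `0` and acts by `τ` on the others. -/
def liftPerm (τ : Equiv.Perm (Fin n)) : Equiv.Perm (Fin (n + 1)) :=
  Equiv.Perm.decomposeFin.symm (0, τ)

theorem liftPerm_zero (τ : Equiv.Perm (Fin n)) : liftPerm τ 0 = 0 := by simp [liftPerm]

theorem liftPerm_succ (τ : Equiv.Perm (Fin n)) (i : Fin n) :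
    liftPerm τ i.succ = (τ i).succ := by simp [liftPerm]

theorem sgn_liftPerm (τ : Equiv.Perm (Fin n)) : sgn 𝕜 (liftPerm τ) = sgn 𝕜 τ := by
  simp [sgn, liftPerm]

theorem decomposeFin_symm_eq (p : Fin (n + 1)) (τ : Equiv.Perm (Fin n)) :
    Equiv.Perm.decomposeFin.symm (p, τ) = Equiv.swap 0 p * liftPerm τ := by
  ext i
  refine Fin.cases ?_ (fun i => ?_) i
  · simp [liftPerm_zero]
  · simp [liftPerm_succ]

theorem liftPerm_inv (τ : Equiv.Perm (Fin n)) : (liftPerm τ)⁻¹ = liftPerm τ⁻¹ := by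
  rw [inv_eq_iff_mul_eq_one]
  ext i
  refine Fin.cases ?_ (fun i => ?_) i
  · simp [liftPerm_zero]
  · simp [liftPerm_succ]

theorem exists_liftPerm {σ : Equiv.Perm (Fin (n + 1))} (h : σ 0 = 0) : ∃ τ, σ = liftPerm τ := by
  obtain ⟨⟨p, τ⟩, rfl⟩ := Equiv.Perm.decomposeFin.symm.surjective σ
  have hp : p = 0 := by simpa using h
  exact ⟨τ, by rw [hp]; rfl⟩

end Antisymmetrization

/-- A family of products `x *_r y` on a set `P` and of operations `Ad r x` on a module `H`,
together with truncated shifts `S r` on `H` that keep track of the index `r < N`. -/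
structure FormalAction (𝕜 : Type*) [Field 𝕜] (P H : Type*) [AddCommGroup H] [Module 𝕜 H] where
  mul : ℕ → P → P → P
  Ad : ℕ → P → H →ₗ[𝕜] H
  S : ℕ → H →ₗ[𝕜] H
  N : ℕ
  S_S : ∀ r s h, S r (S s h) = S (r + s) h
  S_eq_zero : ∀ r h, N ≤ r → S r h = 0
  S_Ad : ∀ r s x h, S r (Ad s x h) = Ad s x (S r h)

/-! ### The Chevalley–Eilenberg differential as a sum over permutations -/

namespace FormalAction

variable {𝕜 : Type*} [Field 𝕜] {P H : Type*} [AddCommGroup H] [Module 𝕜 H]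
  (A : FormalAction 𝕜 P H) {n k : ℕ}

/-- `(x_0, …, x_n) ↦ [x_0, w(x_1, …, x_n)]`. -/
def outer : ((Fin n → P) → H) →ₗ[𝕜] ((Fin (n + 1) → P) → H) where
  toFun w x := ∑ r ∈ Finset.range A.N, A.S r (A.Ad r (x 0) (w (fun i => x i.succ)))
  map_add' w η := by ext x; simp [Finset.sum_add_distrib]
  map_smul' c w := by ext x; simp [Finset.smul_sum]

/-- `(x_0, …, x_{k+1}) ↦ w(x_0, …, x_{k-1}, [x_k, x_{k+1}])`. -/
def inner : ((Fin (k + 1) → P) → H) →ₗ[𝕜] ((Fin (k + 2) → P) → H) where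
  toFun w x := ∑ r ∈ Finset.range A.N, A.S r (w (Fin.snoc (α := fun _ => P)
    (fun i : Fin k => x i.castSucc.castSucc)
    (A.mul r (x (Fin.last k).castSucc) (x (Fin.last (k + 1))))))
  map_add' w η := by ext x; simp [Finset.sum_add_distrib]
  map_smul' c w := by ext x; simp [Finset.smul_sum]

/-- `(x_0, …, x_{k+1}) ↦ w([x_0, x_1], x_2, …, x_{k+1})`. -/
def headInner : ((Fin (k + 1) → P) → H) →ₗ[𝕜] ((Fin (k + 2) → P) → H) where
  toFun w x := ∑ r ∈ Finset.range A.N, A.S r (w (Fin.cons (α := fun _ => P)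
    (A.mul r (x 0) (x 1)) (fun i : Fin k => x i.succ.succ)))
  map_add' w η := by ext x; simp [Finset.sum_add_distrib]
  map_smul' c w := by ext x; simp [Finset.smul_sum]

theorem outer_apply (w : (Fin n → P) → H) (x : Fin (n + 1) → P) :
    A.outer w x = ∑ r ∈ Finset.range A.N, A.S r (A.Ad r (x 0) (w (fun i => x i.succ))) := rfl

theorem inner_apply (w : (Fin (k + 1) → P) → H) (x : Fin (k + 2) → P) :
    A.inner w x = ∑ r ∈ Finset.range A.N, A.S r (w (Fin.snoc (α := fun _ => P)
      (fun i : Fin k => x i.castSucc.castSucc)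
      (A.mul r (x (Fin.last k).castSucc) (x (Fin.last (k + 1)))))) := rfl

theorem headInner_apply (w : (Fin (k + 1) → P) → H) (x : Fin (k + 2) → P) :
    A.headInner w x = ∑ r ∈ Finset.range A.N, A.S r (w (Fin.cons (α := fun _ => P)
      (A.mul r (x 0) (x 1)) (fun i : Fin k => x i.succ.succ))) := rfl

theorem outer_permute (τ : Equiv.Perm (Fin n)) (w : (Fin n → P) → H) :
    A.outer (permute 𝕜 τ w) = permute 𝕜 (liftPerm τ) (A.outer w) := by
  ext x
  simp only [outer_apply, permute_apply, Function.comp_apply, liftPerm_zero, liftPerm_succ]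
  rfl

theorem headInner_permute (τ : Equiv.Perm (Fin k)) (w : (Fin (k + 1) → P) → H) :
    A.headInner (permute 𝕜 (liftPerm τ) w) =
      permute 𝕜 (liftPerm (liftPerm τ)) (A.headInner w) := by
  ext x
  have h1 : liftPerm (liftPerm τ) 1 = 1 := by
    rw [← Fin.succ_zero_eq_one, liftPerm_succ, liftPerm_zero]
  simp only [headInner_apply, permute_apply, Function.comp_apply, liftPerm_zero, liftPerm_succ, h1]
  refine Finset.sum_congr rfl fun r _ => congrArg _ (congrArg w ?_)
  funext i
  refine Fin.cases ?_ (fun i => ?_) i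
  · simp [liftPerm_zero]
  · simp [liftPerm_succ]

/-- Moving the bracket from the last slot of `w` to the first is one rotation of the slots of `w`,
but two rotations of the underlying arguments, because the bracket holds two of them. -/
theorem headInner_permute_finRotate (w : (Fin (k + 1) → P) → H) :
    A.headInner (permute 𝕜 (finRotate (k + 1)) w) =
      permute 𝕜 (finRotate (k + 2) * finRotate (k + 2)) (A.inner w) := by
  ext x
  have h1 : ∀ i : Fin k, finRotate (k + 2) (finRotate (k + 2) i.castSucc.castSucc) =
      i.succ.succ := fun i => by
    rw [finRotate_apply, finRotate_apply, Fin.coeSucc_eq_succ, Fin.succ_castSucc,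
      Fin.coeSucc_eq_succ]
  have h2 : finRotate (k + 2) (finRotate (k + 2) (Fin.last k).castSucc) = 0 := by
    rw [finRotate_apply (Fin.last k).castSucc, Fin.coeSucc_eq_succ, Fin.succ_last,
      finRotate_last]
  have h3 : finRotate (k + 2) (finRotate (k + 2) (Fin.last (k + 1))) = 1 := by
    rw [finRotate_last, finRotate_apply, zero_add]
  simp only [headInner_apply, inner_apply, permute_apply, Function.comp_apply, Equiv.Perm.mul_apply,
    h1, h2, h3, Fin.snoc_eq_cons_rotate]
  rfl

/-- The double rotation of the arguments is even, so the sign is that of the rotation of the $k+1$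
slots of `w`. From here on only brackets in the first slot are needed. -/
theorem antisymm_inner {w : (Fin (k + 1) → P) → H} (hw : IsAntisymm 𝕜 w) :
    antisymm 𝕜 (A.inner w) = (-1 : 𝕜) ^ k • antisymm 𝕜 (A.headInner w) := by
  have h := congrArg (antisymm 𝕜) (A.headInner_permute_finRotate w)
  rw [hw, map_smul, map_smul, antisymm_permute, sgn_mul, sgn_mul_self, one_smul] at h
  rw [← h]
  simp [sgn]

theorem antisymm_outer_antisymm (g : (Fin n → P) → H) :
    antisymm 𝕜 (A.outer (antisymm 𝕜 g)) = (n.factorial : 𝕜) • antisymm 𝕜 (A.outer g) := by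
  rw [antisymm_eq g, map_sum]
  have : ∀ τ : Equiv.Perm (Fin n), antisymm 𝕜 (A.outer (sgn 𝕜 τ • permute 𝕜 τ g)) =
      antisymm 𝕜 (A.outer g) := fun τ => by
    rw [map_smul, outer_permute, map_smul, antisymm_permute, smul_smul, sgn_liftPerm,
      sgn_mul_self, one_smul]
  rw [map_sum, Finset.sum_congr rfl fun τ _ => this τ]
  simp [Finset.card_univ, Fintype.card_perm, Nat.cast_smul_eq_nsmul]

/-- The transpositions $(0\,p)$ represent the cosets of the stabilizer of $0$. By antisymmetry of
`w`, the $n!$ elements of a coset contribute equally. -/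
theorem antisymm_outer {w : (Fin n → P) → H} (hw : IsAntisymm 𝕜 w) :
    antisymm 𝕜 (A.outer w) = (n.factorial : 𝕜) • ∑ p : Fin (n + 1),
      sgn 𝕜 (Equiv.swap 0 p) • permute 𝕜 (Equiv.swap 0 p) (A.outer w) := by
  rw [antisymm_eq, ← Equiv.sum_comp Equiv.Perm.decomposeFin.symm, Fintype.sum_prod_type,
    Finset.smul_sum]
  refine Finset.sum_congr rfl fun p _ => ?_
  have : ∀ τ : Equiv.Perm (Fin n), sgn 𝕜 (Equiv.Perm.decomposeFin.symm (p, τ)) •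
      permute 𝕜 (Equiv.Perm.decomposeFin.symm (p, τ)) (A.outer w) =
      sgn 𝕜 (Equiv.swap 0 p) • permute 𝕜 (Equiv.swap 0 p) (A.outer w) := fun τ => by
    rw [decomposeFin_symm_eq, ← permute_permute, ← outer_permute, hw, map_smul, map_smul,
      smul_smul, sgn_mul, sgn_liftPerm, mul_assoc, sgn_mul_self, mul_one]
  rw [Finset.sum_congr rfl fun τ _ => this τ]
  simp [Finset.card_univ, Fintype.card_perm, Nat.cast_smul_eq_nsmul]

theorem antisymm_headInner_permute (τ : Equiv.Perm (Fin k)) (g : (Fin (k + 1) → P) → H) :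
    antisymm 𝕜 (A.headInner (permute 𝕜 (liftPerm τ) g)) =
      sgn 𝕜 τ • antisymm 𝕜 (A.headInner g) := by
  rw [headInner_permute, antisymm_permute, sgn_liftPerm, sgn_liftPerm]

/-- Both sides evaluate to $[x_2,w([x_0,x_1],x_3,\dots)]$. The two shifts commute with each other
and with the adjoint action. -/
theorem headInner_permute_outer (w : (Fin (k + 1) → P) → H) :
    A.headInner (permute 𝕜 (Equiv.swap 0 1) (A.outer w)) =
      permute 𝕜 (Equiv.swap 0 1 * Equiv.swap 0 2) (A.outer (A.headInner w)) := by
  ext x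
  have e0 : (Equiv.swap 0 1 * Equiv.swap 0 2 : Equiv.Perm (Fin (k + 3))) 0 = 2 := by
    rw [Equiv.Perm.mul_apply, Equiv.swap_apply_left,
      Equiv.swap_apply_of_ne_of_ne zero_ne_two.symm one_ne_two.symm]
  have e1 : (Equiv.swap 0 1 * Equiv.swap 0 2 : Equiv.Perm (Fin (k + 3))) (Fin.succ 0) = 0 := by
    rw [Equiv.Perm.mul_apply, Fin.succ_zero_eq_one, Equiv.swap_apply_of_ne_of_ne (by simp)
      one_ne_two, Equiv.swap_apply_right]
  have e2 : (Equiv.swap 0 1 * Equiv.swap 0 2 : Equiv.Perm (Fin (k + 3))) (Fin.succ 1) = 1 := by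
    rw [Equiv.Perm.mul_apply, show Fin.succ (1 : Fin (k + 2)) = 2 from rfl, Equiv.swap_apply_right,
      Equiv.swap_apply_left]
  have e3 : ∀ i : Fin k, (Equiv.swap 0 1 * Equiv.swap 0 2 : Equiv.Perm (Fin (k + 3)))
      i.succ.succ.succ = i.succ.succ.succ := fun i => by
    have h2 : i.succ.succ.succ ≠ 2 := fun h => Fin.succ_succ_ne_one i (Fin.succ_injective _ h)
    have h1 : i.succ.succ.succ ≠ 1 := Fin.succ_succ_ne_one _
    rw [Equiv.Perm.mul_apply, Equiv.swap_apply_of_ne_of_ne (Fin.succ_ne_zero _) h2,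
      Equiv.swap_apply_of_ne_of_ne (Fin.succ_ne_zero _) h1]
  simp only [headInner_apply, outer_apply, permute_apply, Function.comp_apply, e0, e1, e2, e3,
    map_sum]
  rw [Finset.sum_comm]
  refine Finset.sum_congr rfl fun s _ => Finset.sum_congr rfl fun r _ => ?_
  rw [A.S_S, add_comm, ← A.S_S, A.S_Ad r s, Equiv.swap_apply_left]
  congr 4
  funext i
  refine Fin.cases ?_ (fun i => ?_) i
  · simp
  · rw [Equiv.swap_apply_of_ne_of_ne (Fin.succ_ne_zero _) (Fin.succ_succ_ne_one i)]
    simp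

/-- The transposition $(0\;i{+}1)$ is the conjugate of $(0\,1)$ by a permutation fixing $0$. The two
conjugating factors contribute the same sign, which reduces the claim to `headInner_permute_outer`.
-/
theorem antisymm_headInner_permute_outer {w : (Fin (k + 1) → P) → H} (hw : IsAntisymm 𝕜 w)
    (i : Fin (k + 1)) :
    antisymm 𝕜 (A.headInner (permute 𝕜 (Equiv.swap 0 i.succ) (A.outer w))) =
      antisymm 𝕜 (A.outer (A.headInner w)) := by
  have h1 : Equiv.swap 0 i.succ = liftPerm (Equiv.swap 0 i) * Equiv.swap 0 1 *
      liftPerm (Equiv.swap 0 i) := by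
    have := Equiv.swap_apply_apply (liftPerm (Equiv.swap 0 i)) 0 1
    rw [liftPerm_inv, Equiv.swap_inv, liftPerm_zero, ← Fin.succ_zero_eq_one, liftPerm_succ,
      Equiv.swap_apply_left] at this
    exact this
  rw [h1, ← permute_permute, ← permute_permute, ← outer_permute, hw, map_smul, map_smul, map_smul,
    map_smul, map_smul, antisymm_headInner_permute, smul_smul, sgn_mul_self, one_smul,
    headInner_permute_outer, antisymm_permute, sgn_swap_mul_swap, one_smul]

/-- Either the bracket $[x_0,x_1]$ itself acts on `w`, or one of the other $k+1$ arguments acts and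
the bracket stays inside `w`; the latter terms all agree after antisymmetrization. -/
theorem antisymm_headInner_antisymm_outer {w : (Fin (k + 1) → P) → H} (hw : IsAntisymm 𝕜 w) :
    antisymm 𝕜 (A.headInner (antisymm 𝕜 (A.outer w))) = ((k + 1).factorial : 𝕜) •
      (antisymm 𝕜 (A.headInner (A.outer w)) -
        ((k + 1 : ℕ) : 𝕜) • antisymm 𝕜 (A.outer (A.headInner w))) := by
  rw [antisymm_outer A hw, map_smul, map_smul, map_sum, map_sum, Fin.sum_univ_succ]
  have h : ∀ i : Fin (k + 1), antisymm 𝕜 (A.headInner (sgn 𝕜 (Equiv.swap 0 i.succ) •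
      permute 𝕜 (Equiv.swap 0 i.succ) (A.outer w))) =
      -antisymm 𝕜 (A.outer (A.headInner w)) := fun i => by
    rw [map_smul, map_smul, antisymm_headInner_permute_outer A hw,
      sgn_swap _ (Fin.succ_ne_zero i).symm, neg_smul, one_smul]
  rw [Finset.sum_congr rfl fun i _ => h i]
  have h0 : permute 𝕜 (Equiv.swap 0 0) (A.outer w) = A.outer w := by
    ext x; simp [permute_apply]
  rw [h0, Equiv.swap_self]
  rw [Finset.sum_const, Finset.card_univ, Fintype.card_fin, ← Nat.cast_smul_eq_nsmul 𝕜]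
  simp [sgn, sub_eq_add_neg]

/-- The Chevalley–Eilenberg differential as a sum over permutations. -/
def diff (k : ℕ) (w : (Fin (k + 1) → P) → H) : (Fin (k + 2) → P) → H :=
  ((-1 : 𝕜) ^ (k + 1) / ((k + 1).factorial : 𝕜)) • antisymm 𝕜 (A.outer w) +
    (1 / (2 * (k.factorial : 𝕜))) • antisymm 𝕜 (A.inner w)

theorem isAntisymm_diff (w : (Fin (k + 1) → P) → H) : IsAntisymm 𝕜 (A.diff k w) :=
  ((isAntisymm_antisymm _).smul _).add ((isAntisymm_antisymm _).smul _)

variable [CharZero 𝕜]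

/-- The hypothesis says that the adjoint action is a representation. Antisymmetrizing its left side
gives twice the iterated action. -/
theorem antisymm_outer_outer {w : (Fin n → P) → H}
    (hJ : A.outer (A.outer w) - permute 𝕜 (Equiv.swap 0 1) (A.outer (A.outer w)) =
      A.headInner (A.outer w)) :
    antisymm 𝕜 (A.outer (A.outer w)) = (1 / 2 : 𝕜) • antisymm 𝕜 (A.headInner (A.outer w)) := by
  rw [← hJ, map_sub, antisymm_permute, sgn_swap _ (by simp), neg_smul, one_smul, sub_neg_eq_add,
    ← two_smul 𝕜, smul_smul]
  norm_num

/-- The condition on `τ` says that the two brackets are not nested, so two slots of `w` hold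
brackets of disjoint pairs. Exchanging the pairs is even on the arguments but a transposition of
slots of `w`. -/
theorem antisymm_headInner_permute_headInner {w : (Fin (k + 1) → P) → H} (hw : IsAntisymm 𝕜 w)
    (τ : Equiv.Perm (Fin (k + 2))) (h0 : τ 0 ≠ 0) (h1 : τ 1 ≠ 0) :
    antisymm 𝕜 (A.headInner (permute 𝕜 τ (A.headInner w))) = 0 := by
  obtain ⟨a, ha⟩ := Fin.exists_succ_eq.2 h0
  obtain ⟨b, hb⟩ := Fin.exists_succ_eq.2 h1
  have hab : a ≠ b := fun h => by
    have := τ.injective (ha.symm.trans ((congrArg Fin.succ h).trans hb))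
    simp at this
  -- The bracket $[x_0,x_1]$ occupies slot `j.succ` of `w`; slot $0$ holds the other bracket.
  obtain ⟨j, hj⟩ : ∃ j : Fin k, τ j.succ.succ = 0 := by
    obtain ⟨i, hi⟩ := τ.surjective 0
    obtain ⟨i, rfl⟩ := Fin.exists_succ_eq.2 (fun h : i = 0 => h0 (h ▸ hi))
    obtain ⟨i, rfl⟩ := Fin.exists_succ_eq.2 (fun h : i = 0 => h1 (by rw [h] at hi; exact hi))
    exact ⟨i, hi⟩
  have hb1 : b.succ.succ ≠ 1 := Fin.succ_succ_ne_one _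
  have ha1 : a.succ.succ ≠ 1 := Fin.succ_succ_ne_one _
  have hab' : a.succ.succ ≠ b.succ.succ := fun h => hab (by simpa using h)
  -- The shift by two is the passage from arguments of the outer expression to those of `x`, where
  -- $[x_0,x_1]$ takes up two places.
  refine antisymm_eq_zero_of_permute_eq_neg
    (ρ := Equiv.swap 0 a.succ.succ * Equiv.swap 1 b.succ.succ) ?_ ?_
  · rw [sgn_mul, sgn_swap _ (Fin.succ_ne_zero _).symm, sgn_swap _ hb1.symm]
    simp
  set θ : Equiv.Perm (Fin (k + 3)) := Equiv.swap 0 a.succ.succ * Equiv.swap 1 b.succ.succ with hθ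
  have t0 : θ 0 = a.succ.succ := by
    rw [hθ, Equiv.Perm.mul_apply, Equiv.swap_apply_of_ne_of_ne (by simp) (Fin.succ_ne_zero _).symm,
      Equiv.swap_apply_left]
  have t1 : θ 1 = b.succ.succ := by
    rw [hθ, Equiv.Perm.mul_apply, Equiv.swap_apply_left,
      Equiv.swap_apply_of_ne_of_ne (Fin.succ_ne_zero _) hab'.symm]
  have ta : θ a.succ.succ = 0 := by
    rw [hθ, Equiv.Perm.mul_apply, Equiv.swap_apply_of_ne_of_ne ha1 hab', Equiv.swap_apply_right]
  have tb : θ b.succ.succ = 1 := by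
    rw [hθ, Equiv.Perm.mul_apply, Equiv.swap_apply_right,
      Equiv.swap_apply_of_ne_of_ne (by simp) ha1.symm]
  have tc : ∀ c : Fin (k + 1), c ≠ a → c ≠ b → θ c.succ.succ = c.succ.succ := fun c hca hcb => by
    have hc1 : c.succ.succ ≠ 1 := Fin.succ_succ_ne_one _
    rw [hθ, Equiv.Perm.mul_apply, Equiv.swap_apply_of_ne_of_ne hc1 (by simpa using hcb),
      Equiv.swap_apply_of_ne_of_ne (Fin.succ_ne_zero _) (by simpa using hca)]
  ext x
  simp only [headInner_apply, permute_apply, Function.comp_apply, Pi.neg_apply, map_sum, ← ha, ← hb,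
    Fin.cons_succ, t0, t1, ta, tb]
  rw [Finset.sum_comm, ← Finset.sum_neg_distrib]
  refine Finset.sum_congr rfl fun s _ => ?_
  rw [← Finset.sum_neg_distrib]
  refine Finset.sum_congr rfl fun r _ => ?_
  rw [A.S_S, A.S_S, add_comm, ← map_neg]
  congr 1
  have hsw := congrFun (hw (Equiv.swap 0 j.succ)) (Fin.cons (α := fun _ => P)
    (A.mul r (x a.succ.succ) (x b.succ.succ)) (fun i => Fin.cons (α := fun _ => P)
    (A.mul s (x 0) (x 1)) (fun i => x i.succ.succ) (τ i.succ.succ)))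
  rw [sgn_swap _ (Fin.succ_ne_zero _).symm, neg_smul, one_smul, permute_apply] at hsw
  rw [Pi.neg_apply] at hsw
  rw [← neg_eq_iff_eq_neg.2 hsw, neg_neg]
  congr 1
  funext i
  refine Fin.cases ?_ (fun i => ?_) i
  · simp [hj]
  by_cases hij : i = j
  · subst hij
    simp [hj]
  have hi0 : τ i.succ.succ ≠ 0 := fun h => hij (by
    have := τ.injective (h.trans hj.symm)
    simpa using this)
  obtain ⟨c, hc⟩ := Fin.exists_succ_eq.2 hi0
  have hca : c ≠ a := fun h => by
    have := τ.injective (hc.symm.trans ((congrArg Fin.succ h).trans ha))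
    simp at this
  have hcb : c ≠ b := fun h => Fin.succ_succ_ne_one i
    (τ.injective (hc.symm.trans ((congrArg Fin.succ h).trans hb)))
  rw [Function.comp_apply, Equiv.swap_apply_of_ne_of_ne (Fin.succ_ne_zero _) (by simpa using hij),
    Fin.cons_succ, Fin.cons_succ, ← hc, Fin.cons_succ, Fin.cons_succ, tc c hca hcb]

/-- Disjoint brackets cancel in pairs. Nested ones vanish by the Jacobi identity: its three terms
are even permutations of one another, so three times the antisymmetrization is zero. -/
theorem antisymm_headInner_antisymm_headInner {w : (Fin (k + 1) → P) → H} (hw : IsAntisymm 𝕜 w)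
    (hS : permute 𝕜 (Equiv.swap 0 1) (A.headInner w) = -A.headInner w)
    (hJ : A.headInner (A.headInner w) +
      permute 𝕜 (Equiv.swap 0 1 * Equiv.swap 0 2) (A.headInner (A.headInner w)) +
      permute 𝕜 (Equiv.swap 0 2 * Equiv.swap 0 1) (A.headInner (A.headInner w)) = 0) :
    antisymm 𝕜 (A.headInner (antisymm 𝕜 (A.headInner w))) = 0 := by
  have hz : antisymm 𝕜 (A.headInner (A.headInner w)) = 0 := by
    have h3 := congrArg (antisymm 𝕜) hJ
    rw [map_add, map_add, antisymm_permute, antisymm_permute, sgn_swap_mul_swap, sgn_swap_mul_swap',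
      map_zero, one_smul] at h3
    have h4 : (3 : 𝕜) • antisymm 𝕜 (A.headInner (A.headInner w)) = 0 := by
      rw [← h3]; module
    exact (smul_eq_zero.1 h4).resolve_left three_ne_zero
  have key : ∀ τ : Equiv.Perm (Fin (k + 2)), τ 0 = 0 →
      antisymm 𝕜 (A.headInner (permute 𝕜 τ (A.headInner w))) = 0 := fun τ hτ => by
    obtain ⟨ρ, rfl⟩ := exists_liftPerm hτ
    rw [antisymm_headInner_permute, hz, smul_zero]
  rw [antisymm_eq (A.headInner w), map_sum, map_sum]
  refine Finset.sum_eq_zero fun τ _ => ?_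
  rw [map_smul, map_smul]
  by_cases h0 : τ 0 = 0
  · rw [key τ h0, smul_zero]
  by_cases h1 : τ 1 = 0
  -- Antisymmetry of the bracket moves the nested bracket from its second entry to its first.
  · have h := key (τ * Equiv.swap 0 1) (by simpa using h1)
    rw [← permute_permute, hS, map_neg, map_neg, map_neg, neg_eq_zero] at h
    rw [h, smul_zero]
  · rw [antisymm_headInner_permute_headInner A hw τ h0 h1, smul_zero]

theorem diff_diff {w : (Fin (k + 1) → P) → H} (hw : IsAntisymm 𝕜 w)
    (hS : permute 𝕜 (Equiv.swap 0 1) (A.headInner w) = -A.headInner w)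
    (hJ : A.outer (A.outer w) - permute 𝕜 (Equiv.swap 0 1) (A.outer (A.outer w)) =
      A.headInner (A.outer w))
    (hJ' : A.headInner (A.headInner w) +
      permute 𝕜 (Equiv.swap 0 1 * Equiv.swap 0 2) (A.headInner (A.headInner w)) +
      permute 𝕜 (Equiv.swap 0 2 * Equiv.swap 0 1) (A.headInner (A.headInner w)) = 0) :
    A.diff (k + 1) (A.diff k w) = 0 := by
  rw [diff, antisymm_inner A (A.isAntisymm_diff w), diff, antisymm_inner A hw]
  simp only [map_add, map_smul, antisymm_outer_antisymm, antisymm_headInner_antisymm_outer A hw,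
    antisymm_headInner_antisymm_headInner A hw hS hJ', antisymm_outer_outer A hJ]
  have hk : (k.factorial : 𝕜) ≠ 0 := Nat.cast_ne_zero.2 k.factorial_ne_zero
  have hk1 : (k + 1 : 𝕜) ≠ 0 := by exact_mod_cast Nat.succ_ne_zero k
  have hk2 : (k + 1 + 1 : 𝕜) ≠ 0 := by exact_mod_cast Nat.succ_ne_zero (k + 1)
  have hs : ((-1 : 𝕜) ^ k) * (-1) ^ k = 1 := by rw [← mul_pow]; simp
  generalize antisymm 𝕜 (A.headInner (A.outer w)) = b
  generalize antisymm 𝕜 (A.outer (A.headInner w)) = q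
  simp only [Nat.factorial_succ, Nat.cast_mul, Nat.cast_add, Nat.cast_one, pow_succ]
  generalize (-1 : 𝕜) ^ k = u at hs
  -- Two unknowns remain, $b$ for $\mathrm{Alt}([[x,y],w])$ and $q$ for
  -- $\mathrm{Alt}([x,w([y,z])])$; their coefficients vanish separately.
  match_scalars
  · field_simp
    linear_combination (0 : 𝕜) * hs
  · field_simp
    linear_combination (0 : 𝕜) * hs

theorem diff_outer {w : (Fin 0 → P) → H}
    (hJ : A.outer (A.outer w) - permute 𝕜 (Equiv.swap 0 1) (A.outer (A.outer w)) =
      A.headInner (A.outer w)) :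
    A.diff 0 (A.outer w) = 0 := by
  have h1 : IsAntisymm 𝕜 (A.outer w) := fun σ => by
    have : σ = 1 := Equiv.ext fun i => Subsingleton.elim (α := Fin 1) _ _
    rw [this, sgn_one, one_smul]; rfl
  rw [diff, antisymm_inner A h1, antisymm_outer_outer A hJ]
  module

end FormalAction

end RedLie

end

noncomputable section

namespace RedLie

/-! ### The operators λ and T, and their expansion under permutations -/

section Operators

variable {𝕜 : Type*} [RCLike 𝕜]

theorem lamCoeff_symm (a b c : 𝕜) (p q : ℕ) :
    lamCoeff b a c q p = (-1) ^ (p + q) * lamCoeff a b c p q := by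
  have h : (-1 : 𝕜) ^ q * (-1) ^ q = 1 := by rw [← mul_pow]; simp
  simp only [lamCoeff, pow_add]
  linear_combination (-(-1 : 𝕜) ^ p * ((ascPochhammer 𝕜 p).eval (c + b - a) / (p.factorial : 𝕜)) *
    ((ascPochhammer 𝕜 q).eval (c + a - b) / (q.factorial : 𝕜))) * h

theorem lam_apply (a b : 𝕜) (m : ℕ) (f g : Smooth 𝕜) :
    lam a b m f g = ∑ pq ∈ Finset.HasAntidiagonal.antidiagonal m,
      lamCoeff a b (a + b - 1 - m) pq.1 pq.2 • ((D 𝕜 ^ pq.1) f * (D 𝕜 ^ pq.2) g) := by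
  simp [lam, LinearMap.sum_apply]

theorem lam_symm (a b : 𝕜) (m : ℕ) (f g : Smooth 𝕜) :
    lam b a m g f = (-1 : 𝕜) ^ m • lam a b m f g := by
  rw [lam_apply, lam_apply, Finset.smul_sum, ← Finset.Nat.sum_antidiagonal_swap]
  refine Finset.sum_congr rfl fun pq hpq => ?_
  rw [Finset.HasAntidiagonal.mem_antidiagonal] at hpq
  rw [smul_smul, Prod.fst_swap, Prod.snd_swap, lamCoeff_symm, hpq, mul_comm ((D 𝕜 ^ pq.2) g),
    add_comm b a]

theorem D_one : D 𝕜 (1 : Smooth 𝕜) = 0 := by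
  ext x
  exact deriv_const x (1 : 𝕜)

/-- Only $q=0$ survives because $\partial 1=0$, and its coefficient contains $(1-m)_m$, which
vanishes for $m\ge1$. This explains why $b^0$ has the single component $\Gamma^*(X,\omega)_0$. -/
theorem lam_one (a : 𝕜) (m : ℕ) (f : Smooth 𝕜) :
    lam a 1 m f 1 = if m = 0 then f else 0 := by
  rw [lam_apply, Finset.sum_eq_single (m, 0)]
  · rcases Nat.eq_zero_or_pos m with rfl | hm
    · simp [lamCoeff]
    · obtain ⟨m, rfl⟩ := Nat.exists_eq_succ_of_ne_zero hm.ne'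
      have : (ascPochhammer 𝕜 (m + 1)).eval (-(m : 𝕜)) = 0 := by
        exact ascPochhammer_eval_neg_coe_nat_of_lt (Nat.lt_succ_self m)
      have h2 : a + 1 - 1 - ((m + 1 : ℕ) : 𝕜) + 1 - a = -(m : 𝕜) := by push_cast; ring
      simp only [lamCoeff, h2, this]
      simp
  · rintro ⟨p, q⟩ hpq hne
    rw [Finset.HasAntidiagonal.mem_antidiagonal] at hpq
    obtain ⟨q, rfl⟩ := Nat.exists_eq_succ_of_ne_zero (n := q) (fun h => hne (by
      simp only at hpq; subst h; simp [← hpq]))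
    simp [pow_succ, Module.End.mul_apply, D_one]
  · intro h
    exact absurd (Finset.HasAntidiagonal.mem_antidiagonal.2 (add_zero m)) h

theorem defaultT_one (a : Fin 1 → 𝕜) (m : Fin 0 → ℕ) (f : Fin 1 → Smooth 𝕜) :
    defaultT 1 a m f = f 0 := rfl

theorem defaultT_succ (k : ℕ) (a : Fin (k + 2) → 𝕜) (m : Fin (k + 1) → ℕ)
    (f : Fin (k + 2) → Smooth 𝕜) :
    defaultT (k + 2) a m f =
      lam (a 0) (outDim (n := k + 1) (Fin.tail a) (Fin.tail (n := k) m)) (m 0) (f 0)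
        (defaultT (k + 1) (Fin.tail a) (Fin.tail (n := k) m) (Fin.tail f)) := by
  simp [defaultT]

open ReducedLieAlgebra in
theorem outDim_mergeDim {k : ℕ} (a : Fin (k + 2) → 𝕜) (m : Fin (k + 1) → ℕ) :
    outDim (n := k + 1) (mergeDim a (m (Fin.last k))) (Fin.init (n := k) m) =
      outDim (n := k + 2) a m := by
  simp only [outDim, mergeDim, Fin.sum_univ_castSucc (n := k), Fin.sum_univ_castSucc (n := k + 1),
    Fin.snoc_castSucc, Fin.snoc_last]
  have : ∑ i : Fin (k + 2 - 1), (m i : 𝕜) = ∑ i : Fin k, (m i.castSucc : 𝕜) + m (Fin.last k) :=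
    Fin.sum_univ_castSucc (n := k) fun i => (m i : 𝕜)
  have h2 : ∑ i : Fin (k + 1 - 1), ((Fin.init (n := k) m i : ℕ) : 𝕜) =
    ∑ i : Fin k, (m i.castSucc : 𝕜) := rfl
  rw [this, h2]
  push_cast
  ring

theorem outDim_cons {k : ℕ} (a : Fin (k + 2) → 𝕜) (m : Fin (k + 1) → ℕ) :
    outDim (n := k + 2) a m =
      a 0 + outDim (n := k + 1) (Fin.tail a) (Fin.tail (n := k) m) - 1 - m 0 := by
  have : ∑ i : Fin (k + 2 - 1), (m i : 𝕜) = m 0 + ∑ i : Fin k, (m i.succ : 𝕜) :=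
    Fin.sum_univ_succ (n := k) fun i => (m i : 𝕜)
  have h2 : ∑ i : Fin (k + 1 - 1), ((Fin.tail (n := k) m i : ℕ) : 𝕜) =
    ∑ i : Fin k, (m i.succ : 𝕜) := rfl
  simp only [outDim, Fin.sum_univ_succ (n := k + 1), this, h2]
  simp only [Fin.tail]
  push_cast
  ring

open ReducedLieAlgebra in
theorem tail_mergeDim {k : ℕ} (a : Fin (k + 3) → 𝕜) (r : ℕ) :
    Fin.tail (mergeDim a r) = mergeDim (Fin.tail a) r := by
  funext i
  refine Fin.lastCases ?_ (fun i => ?_) i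
  · simp only [mergeDim, Fin.tail, Fin.succ_last, Fin.snoc_last]
    rw [← Fin.succ_last, ← Fin.succ_last, Fin.succ_castSucc]
  · simp only [mergeDim, Fin.tail, Fin.snoc_castSucc]
    rw [Fin.succ_castSucc, Fin.snoc_castSucc, Fin.succ_castSucc, Fin.succ_castSucc]

-- The nested operator opened at its innermost λ, as needed for cochains with a bracket in the last
-- slot; `defaultT_succ` opens it at the outermost one.
open ReducedLieAlgebra in
theorem defaultT_mergeDim (k : ℕ) (a : Fin (k + 2) → 𝕜) (m : Fin (k + 1) → ℕ)
    (f : Fin (k + 2) → Smooth 𝕜) :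
    defaultT (k + 2) a m f = defaultT (k + 1) (mergeDim a (m (Fin.last k))) (Fin.init (n := k) m)
      (Fin.snoc (α := fun _ => Smooth 𝕜) (fun i : Fin k => f i.castSucc.castSucc)
        (lam (a (Fin.last k).castSucc) (a (Fin.last (k + 1))) (m (Fin.last k))
          (f (Fin.last k).castSucc) (f (Fin.last (k + 1))))) := by
  induction k with
  | zero =>
    rw [defaultT_succ, defaultT_one, defaultT_one]
    have : outDim (n := 1) (Fin.tail a) (Fin.tail (n := 0) m) = a 1 := by
      simp [outDim, Fin.tail]
    rw [this]
    rfl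
  | succ k ih =>
    rw [defaultT_succ, ih, defaultT_succ, tail_mergeDim]
    have h1 : mergeDim a (m (Fin.last (k + 1))) 0 = a 0 :=
      Fin.snoc_castSucc (α := fun _ => 𝕜) (n := k + 1) (i := 0) ..
    have h2 : outDim (n := k + 2) (Fin.tail a) (Fin.tail (n := k + 1) m) =
      outDim (n := k + 1) (mergeDim (Fin.tail a) (m (Fin.last (k + 1))))
        (Fin.tail (n := k) (Fin.init (n := k + 1) m)) := by
      rw [← outDim_mergeDim]
      rfl
    rw [h1, h2]
    congr 2
    funext i
    refine Fin.lastCases ?_ (fun i => ?_) i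
    · simp only [Fin.snoc_last, Fin.tail, Fin.succ_last]
      rfl
    · simp only [Fin.snoc_castSucc, Fin.tail, Fin.succ_castSucc]

theorem sum_multiIdx_cons {E : Type*} [AddCommMonoid E] (k M : ℕ) (F : (Fin (k + 1) → ℕ) → E) :
    ∑ m ∈ multiIdx (k + 1) M, F m =
      ∑ r ∈ Finset.range (M + 1), ∑ m ∈ multiIdx k (M - r), F (Fin.cons r m) := by
  rw [Finset.sum_sigma']
  refine Finset.sum_bij' (fun m _ => ⟨m 0, Fin.tail m⟩) (fun p _ => Fin.cons p.1 p.2) ?_ ?_ ?_ ?_ ?_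
  · intro m hm
    simp only [Finset.mem_piAntidiag, Fin.sum_univ_succ, Finset.mem_sigma, Finset.mem_range,
      Fin.tail] at hm ⊢
    refine ⟨by omega, Nat.eq_sub_of_add_eq' hm.1, by simp⟩
  · rintro ⟨r, m⟩ hm
    simp only [Finset.mem_piAntidiag, Fin.sum_univ_succ, Finset.mem_sigma, Finset.mem_range,
      Fin.cons_zero, Fin.cons_succ] at hm ⊢
    refine ⟨?_, by simp⟩
    rw [hm.2.1]
    omega
  · intro m _; simp
  · intro p _; simp
  · intro m _; simp

theorem sum_multiIdx_snoc {E : Type*} [AddCommMonoid E] (k M : ℕ) (F : (Fin (k + 1) → ℕ) → E) :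
    ∑ m ∈ multiIdx (k + 1) M, F m =
      ∑ r ∈ Finset.range (M + 1), ∑ m ∈ multiIdx k (M - r), F (Fin.snoc m r) := by
  rw [Finset.sum_sigma']
  refine Finset.sum_bij' (fun m _ => ⟨m (Fin.last k), Fin.init m⟩) (fun p _ => Fin.snoc p.2 p.1)
    ?_ ?_ ?_ ?_ ?_
  · intro m hm
    simp only [Finset.mem_piAntidiag, Fin.sum_univ_castSucc, Finset.mem_sigma, Finset.mem_range,
      Fin.init] at hm ⊢
    refine ⟨by omega, Nat.eq_sub_of_add_eq hm.1, by simp⟩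
  · rintro ⟨r, m⟩ hm
    simp only [Finset.mem_piAntidiag, Fin.sum_univ_castSucc, Finset.mem_sigma, Finset.mem_range,
      Fin.snoc_castSucc, Fin.snoc_last] at hm ⊢
    refine ⟨?_, by simp⟩
    rw [hm.2.1]
    omega
  · intro m _; simp
  · intro p _; simp
  · intro m _; simp

theorem sum_multiIdx_two {E : Type*} [AddCommMonoid E] (M : ℕ) (F : (Fin 2 → ℕ) → E) :
    ∑ m ∈ multiIdx 2 M, F m = ∑ rs ∈ Finset.HasAntidiagonal.antidiagonal M, F ![rs.1, rs.2] := by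
  refine Finset.sum_bij' (fun m _ => (m 0, m 1)) (fun p _ => ![p.1, p.2]) ?_ ?_ ?_ ?_ ?_
  · intro m hm
    simpa [Fin.sum_univ_two] using hm
  · intro p hp
    simpa [Fin.sum_univ_two] using hp
  · intro m _; ext i; fin_cases i <;> rfl
  · intro p _; rfl
  · intro m _; congr; ext i; fin_cases i <;> rfl

/-- Permutation of the arguments preserves local intertwiners. -/
theorem domDomCongr_mem_localIntertwiners {n : ℕ} (a : Fin n → 𝕜) (e : 𝕜)
    (σ : Equiv.Perm (Fin n)) {T : MultilinearMap 𝕜 (fun _ : Fin n => Smooth 𝕜) (Smooth 𝕜)}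
    (hT : T ∈ localIntertwiners (a ∘ σ) e) : T.domDomCongr σ ∈ localIntertwiners a e := by
  obtain ⟨h1, h2⟩ := hT
  refine ⟨fun f i x hx => ?_, fun v hv f => ?_⟩
  · exact h1 (f ∘ σ) (σ.symm i) x (by simpa using hx)
  · have := h2 v hv (f ∘ σ)
    rw [← Equiv.sum_comp σ]
    refine Eq.trans (Finset.sum_congr rfl fun j _ => ?_) this
    refine congrArg T ?_
    funext i
    by_cases hij : i = j
    · subst hij; simp
    · simp [Function.update_of_ne hij, Function.update_of_ne (σ.injective.ne hij)]

/-- The default operators with total index `M` are independent, and they expand their permuted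
versions with the coefficients `Z`. -/
structure HasExpansion {n : ℕ} (a : Fin n → 𝕜) (M : ℕ) : Prop where
  linearIndependent : LinearIndependent 𝕜 fun m : multiIdx (n - 1) M => defaultT n a m
  expansion : ∀ (σ : Equiv.Perm (Fin n)), ∀ m' ∈ multiIdx (n - 1) M, ∀ f : Fin n → Smooth 𝕜,
    defaultT n (a ∘ σ) m' (f ∘ σ) = ∑ m ∈ multiIdx (n - 1) M, Z a σ m' m • defaultT n a m f

/-- `Z` is a choice of coefficients with default value zero, so it expands the permuted operator as
soon as some expansion exists. -/
theorem expansion_of_mem_span {n : ℕ} (a : Fin n → 𝕜) (M : ℕ) (σ : Equiv.Perm (Fin n))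
    (m' : Fin (n - 1) → ℕ) (hm' : m' ∈ multiIdx (n - 1) M)
    (h : (defaultT n (a ∘ σ) m').domDomCongr σ ∈
      Submodule.span 𝕜 (Set.range fun m : multiIdx (n - 1) M => defaultT n a m))
    (f : Fin n → Smooth 𝕜) :
    defaultT n (a ∘ σ) m' (f ∘ σ) = ∑ m ∈ multiIdx (n - 1) M, Z a σ m' m • defaultT n a m f := by
  have hM : ∑ i, m' i = M := (Finset.mem_piAntidiag.1 hm').1
  subst hM
  obtain ⟨c, hc⟩ := (Submodule.mem_span_range_iff_exists_fun 𝕜).1 h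
  have hex : ∃ z : (Fin (n - 1) → ℕ) → 𝕜, (∀ m, ∑ i, m i ≠ ∑ i, m' i → z m = 0) ∧
      ∀ f : Fin n → Smooth 𝕜, defaultT n (a ∘ σ) m' (f ∘ σ) =
        ∑ m ∈ multiIdx (n - 1) (∑ i, m' i), z m • defaultT n a m f := by
    classical
    refine ⟨fun m => if hm : m ∈ multiIdx (n - 1) (∑ i, m' i) then c ⟨m, hm⟩ else 0,
      fun m hm => dif_neg fun h => hm (Finset.mem_piAntidiag.1 h).1, fun f => ?_⟩
    have := congrArg (fun T => T f) hc
    simp only [sum_apply, smul_apply,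
      MultilinearMap.domDomCongr_apply] at this
    rw [← Finset.sum_coe_sort]
    refine this.symm.trans (Finset.sum_congr rfl fun m _ => ?_)
    simp only [dif_pos m.2]
  have hZ : ∀ m, Z a σ m' m = hex.choose m := fun m => by rw [Z, dif_pos hex]
  simp only [hZ]
  exact hex.choose_spec.2 f

theorem HasExpansion.of_isDefaultBasis {n : ℕ} {a : Fin n → 𝕜} {M : ℕ}
    (h : ∀ σ : Equiv.Perm (Fin n), IsDefaultBasis (a ∘ σ) M) : HasExpansion a M := by
  have h1 : IsDefaultBasis a M := h 1
  refine ⟨h1.1, fun σ m' hm' f => expansion_of_mem_span a M σ m' hm' ?_ f⟩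
  rw [h1.2]
  refine domDomCongr_mem_localIntertwiners a _ σ ?_
  have h2 := (h σ).2
  rw [show ∑ i, (a ∘ σ) i = ∑ i, a i from Equiv.sum_comp σ a] at h2
  rw [← h2]
  exact Submodule.subset_span ⟨⟨m', hm'⟩, rfl⟩

/-- The basis assumption starts at $n=2$. For $n=1$ the operator is the identity, which is nonzero
on the constant function $1$. -/
theorem HasExpansion.one (a : Fin 1 → 𝕜) (M : ℕ) : HasExpansion a M := by
  have hs : Subsingleton (Fin (1 - 1) → ℕ) := inferInstanceAs (Subsingleton (Fin 0 → ℕ))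
  refine ⟨?_, fun σ m' hm' f => expansion_of_mem_span a M σ m' hm' ?_ f⟩
  · rw [Fintype.linearIndependent_iffₛ]
    intro c d h m
    rw [Fintype.sum_subsingleton _ m, Fintype.sum_subsingleton _ m] at h
    have h1 : c m • (1 : Smooth 𝕜) = d m • (1 : Smooth 𝕜) :=
      congrArg (fun T => T fun _ => (1 : Smooth 𝕜)) h
    have h0 := congrArg (fun f : Smooth 𝕜 => (f : ℝ → 𝕜) 0) h1
    simpa using h0
  · refine Submodule.subset_span ⟨⟨m', hm'⟩, ?_⟩
    ext f x
    have : f (σ 0) = f 0 := congrArg f (Subsingleton.elim (α := Fin 1) _ _)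
    change (f 0 : ℝ → 𝕜) x = (f (σ 0) : ℝ → 𝕜) x
    rw [this]

-- Applying a linear functional of $V$ to the first tensor factor reduces the claim to independence
-- of the operators; functionals separate the points of $V$.
open TensorProduct in
theorem HasExpansion.eq_zero {V : Type*} [AddCommGroup V] [Module 𝕜 V] {n : ℕ} {a : Fin n → 𝕜}
    {M : ℕ} (h : HasExpansion a M) (v : (Fin (n - 1) → ℕ) → V)
    (hv : ∀ f, ∑ m ∈ multiIdx (n - 1) M, v m ⊗ₜ[𝕜] defaultT n a m f = 0)
    (m : Fin (n - 1) → ℕ) (hm : m ∈ multiIdx (n - 1) M) : v m = 0 := by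
  rw [← Module.forall_dual_apply_eq_zero_iff 𝕜]
  intro φ
  have hφ : ∑ m : multiIdx (n - 1) M, φ (v m) • defaultT n a m =
      ∑ m : multiIdx (n - 1) M, (0 : 𝕜) • defaultT n a m := by
    ext1 f
    have h2 := congrArg (TensorProduct.lift ((LinearMap.lsmul 𝕜 (Smooth 𝕜)).comp φ))
      (hv f)
    rw [map_sum, map_zero, ← Finset.sum_coe_sort] at h2
    rw [sum_apply, sum_apply]
    simpa using h2
  exact Fintype.linearIndependent_iffₛ.1 h.linearIndependent (fun m => φ (v m)) (fun _ => 0) hφ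
    ⟨m, hm⟩

end Operators

end RedLie

end

/-! ### Smeared elements and their Jacobi identity -/

noncomputable section

namespace RedLie

/-- Group the double sum by $m=r+s$. For $m<N$ the whole antidiagonal lies in the range of
summation, and for $m\ge N$ the shift is zero. -/
theorem FormalAction.sum_S_S_eq_zero {𝕜 : Type*} [Field 𝕜] {P H : Type*} [AddCommGroup H]
    [Module 𝕜 H] (A : FormalAction 𝕜 P H) (G : ℕ → ℕ → H)
    (hG : ∀ m, ∑ rs ∈ Finset.HasAntidiagonal.antidiagonal m, G rs.1 rs.2 = 0) :
    ∑ r ∈ Finset.range A.N, ∑ s ∈ Finset.range A.N, A.S r (A.S s (G r s)) = 0 := by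
  have h : ∑ m ∈ Finset.range A.N, A.S m
      (∑ rs ∈ Finset.HasAntidiagonal.antidiagonal m, G rs.1 rs.2) = 0 :=
    Finset.sum_eq_zero fun m _ => by rw [hG, map_zero]
  rw [← h, ← Finset.sum_product']
  simp only [map_sum]
  rw [Finset.sum_sigma']
  symm
  refine Finset.sum_of_injOn (fun p => p.2) ?_ ?_ ?_ ?_
  · rintro ⟨m, r, s⟩ hp ⟨m', r', s'⟩ hp' heq
    simp only [Finset.coe_sigma, Set.mem_sigma_iff, Finset.mem_coe,
      Finset.HasAntidiagonal.mem_antidiagonal, Prod.mk.injEq] at hp hp' heq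
    obtain ⟨rfl, rfl⟩ := heq
    obtain rfl : m = m' := hp.2.symm.trans hp'.2
    rfl
  · rintro ⟨m, r, s⟩ hp
    simp only [Finset.coe_sigma, Set.mem_sigma_iff, Finset.mem_coe, Finset.mem_range,
      Finset.HasAntidiagonal.mem_antidiagonal, Finset.mem_product] at hp ⊢
    omega
  · rintro ⟨r, s⟩ _ hne
    rw [A.S_S]
    refine A.S_eq_zero _ _ (not_lt.1 fun hlt => hne ⟨⟨r + s, r, s⟩, ?_, rfl⟩)
    simp only [Finset.coe_sigma, Set.mem_sigma_iff, Finset.mem_coe, Finset.mem_range,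
      Finset.HasAntidiagonal.mem_antidiagonal]
    exact ⟨hlt, trivial⟩
  · rintro ⟨m, r, s⟩ hp
    simp only [Finset.mem_sigma, Finset.HasAntidiagonal.mem_antidiagonal] at hp
    rw [A.S_S, hp.2]

namespace ReducedLieAlgebra

open TensorProduct

variable {𝕜 : Type*} [RCLike 𝕜] {V : Type*} [AddCommGroup V] [Module 𝕜 V]
  (L : ReducedLieAlgebra 𝕜 V)

/-- A homogeneous element of `V` together with a test function that smears it. -/
structure SmearedVec where
  dim : 𝕜
  vec : V
  fn : Smooth 𝕜
  mem : vec ∈ L.gr dim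

variable {L}

/-- The smeared element as a pure tensor. -/
def SmearedVec.tensor (x : L.SmearedVec) : V ⊗[𝕜] Smooth 𝕜 := x.vec ⊗ₜ x.fn

/-- The component of index `r` of the bracket of smeared elements. -/
def SmearedVec.mul (r : ℕ) (x y : L.SmearedVec) : L.SmearedVec where
  dim := x.dim + y.dim - 1 - r
  vec := L.Γ r x.vec y.vec
  fn := lam x.dim y.dim r x.fn y.fn
  mem := L.Γ_mem r _ _ _ x.mem _ y.mem

namespace SmearedVec

theorem tensor_mul (r : ℕ) (x y : L.SmearedVec) :
    (mul r x y).tensor = L.Γ r x.vec y.vec ⊗ₜ lam x.dim y.dim r x.fn y.fn := rfl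

theorem tensor_mul_symm (r : ℕ) (x y : L.SmearedVec) :
    (mul r x y).tensor = -(mul r y x).tensor := by
  rw [tensor_mul, tensor_mul, L.Γ_symm, lam_symm y.dim x.dim, smul_tmul, smul_smul, ← pow_add,
    ← tmul_neg]
  congr 1
  rw [show r + 1 + r = 2 * r + 1 by ring, pow_succ, pow_mul]
  simp

theorem mul_mul_comm_tensor (r s : ℕ) (x y z : L.SmearedVec) :
    (mul r x (mul s y z)).tensor = -(mul r x (mul s z y)).tensor := by
  have h : (mul s z y).dim = (mul s y z).dim := by simp only [mul]; ring
  rw [tensor_mul, tensor_mul, h]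
  have h2 := congrArg (TensorProduct.map (L.Γ r x.vec) (lam x.dim (mul s y z).dim r x.fn))
    (tensor_mul_symm s y z)
  rw [map_neg] at h2
  exact h2

end SmearedVec

open SmearedVec

theorem hasExpansion (hL : L.HasDefaultBases) {n : ℕ} (hn : 1 ≤ n) (a : Fin n → 𝕜) (M : ℕ)
    (ha : ∀ i, L.gr (a i) ≠ ⊥) (he : L.gr (∑ i, a i - M - n + 1) ≠ ⊥) : HasExpansion a M := by
  rcases hn.eq_or_lt with rfl | hn
  · exact HasExpansion.one a M
  · refine HasExpansion.of_isDefaultBasis fun σ => hL n (a ∘ σ) M hn (fun i => ha _) ?_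
    rwa [show ∑ i, (a ∘ σ) i = ∑ i, a i from Equiv.sum_comp σ a]

theorem tmul_expansion (hL : L.HasDefaultBases) {n : ℕ} (hn : 1 ≤ n) (a : Fin n → 𝕜)
    (σ : Equiv.Perm (Fin n)) (m' : Fin (n - 1) → ℕ) (v : V) (hv : v ∈ L.gr (outDim a m'))
    (hv0 : (∃ i, L.gr (a i) = ⊥) → v = 0) (f : Fin n → Smooth 𝕜) :
    v ⊗ₜ[𝕜] defaultT n (a ∘ σ) m' (f ∘ σ) =
      ∑ m ∈ multiIdx (n - 1) (∑ i, m' i), (Z a σ m' m • v) ⊗ₜ[𝕜] defaultT n a m f := by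
  -- The bases are only assumed for dimensions occurring in $V$; whenever one does not occur, `v`
  -- vanishes.
  by_cases h0 : v = 0
  · simp [h0]
  have ha : ∀ i, L.gr (a i) ≠ ⊥ := fun i hi => h0 (hv0 ⟨i, hi⟩)
  have he : L.gr (∑ i, a i - (∑ i, m' i : ℕ) - n + 1) ≠ ⊥ := fun h => h0 (by
    have : outDim a m' = ∑ i, a i - (∑ i, m' i : ℕ) - n + 1 := by simp [outDim]
    rw [this, h] at hv
    exact (Submodule.mem_bot 𝕜).1 hv)
  rw [(hasExpansion hL hn a _ ha he).expansion σ m' (by simp) f, tmul_sum]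
  simp only [tmul_smul, smul_tmul']

theorem defaultT_three (x y z : L.SmearedVec) (r s : ℕ) :
    defaultT 3 ![x.dim, y.dim, z.dim] ![r, s] ![x.fn, y.fn, z.fn] = (mul r x (mul s y z)).fn := by
  rw [defaultT_succ, defaultT_succ, defaultT_one]
  have h1 : outDim (n := 1) (Fin.tail (Fin.tail ![x.dim, y.dim, z.dim]))
      (Fin.tail (n := 0) (Fin.tail (n := 1) ![r, s])) = z.dim := by
    simp [outDim, Fin.tail]
  have h2 : outDim (n := 2) (Fin.tail ![x.dim, y.dim, z.dim]) (Fin.tail (n := 1) ![r, s]) =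
      (mul s y z).dim := by
    simp [outDim, Fin.tail, mul, Fin.sum_univ_two]
    ring
  rw [h1, h2]
  rfl

theorem vec_eq_zero (x : L.SmearedVec) (h : L.gr x.dim = ⊥) : x.vec = 0 := by
  exact (Submodule.mem_bot 𝕜).1 (h.le x.mem)

theorem cyclic_expansion (hL : L.HasDefaultBases) (x y z : L.SmearedVec) (m' : Fin 2 → ℕ) (v : V)
    (hv : v ∈ L.gr (x.dim + y.dim + z.dim - (∑ i, m' i : ℕ) - 2))
    (hv0 : x.vec = 0 ∨ y.vec = 0 ∨ z.vec = 0 → v = 0) :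
    v ⊗ₜ[𝕜] (mul (m' 0) y (mul (m' 1) z x)).fn = ∑ m ∈ multiIdx 2 (∑ i, m' i),
      (Y ![x.dim, y.dim, z.dim] m' m • v) ⊗ₜ[𝕜] (mul (m 0) x (mul (m 1) y z)).fn := by
  have hp : ∀ {α : Type _} (p q r : α), ![p, q, r] ∘ finRotate 3 = ![q, r, p] := fun p q r => by
    funext i; fin_cases i <;> rfl
  have hm : ∀ m : Fin 2 → ℕ, ![m 0, m 1] = m := fun m => by funext i; fin_cases i <;> rfl
  have h := tmul_expansion hL (n := 3) (by norm_num) ![x.dim, y.dim, z.dim] (finRotate 3) m'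
    v ?_ ?_ ![x.fn, y.fn, z.fn]
  · rw [hp] at h
    rw [hp, ← hm m', defaultT_three, hm] at h
    refine h.trans (Finset.sum_congr rfl fun m _ => ?_)
    rw [← defaultT_three, hm]
    rfl
  · convert hv using 2
    simp only [outDim, Fin.sum_univ_succ]
    simp
    ring
  · rintro ⟨i, hi⟩
    fin_cases i
    · exact hv0 (Or.inl (vec_eq_zero x hi))
    · exact hv0 (Or.inr (Or.inl (vec_eq_zero y hi)))
    · exact hv0 (Or.inr (Or.inr (vec_eq_zero z hi)))

theorem mul_mul_mem (x y z : L.SmearedVec) (m : Fin 2 → ℕ) {e : 𝕜}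
    (he : x.dim + y.dim + z.dim - (∑ i, m i : ℕ) - 2 = e) :
    (mul (m 0) x (mul (m 1) y z)).vec ∈ L.gr e := by
  have h : (mul (m 0) x (mul (m 1) y z)).dim = e := by
    rw [← he]
    simp only [mul, Fin.sum_univ_two]
    push_cast
    ring
  exact h ▸ (mul (m 0) x (mul (m 1) y z)).mem

/-- The Jacobi identity for smeared elements. -/
theorem jacobi_tensor (hL : L.HasDefaultBases) (x y z : L.SmearedVec) (M : ℕ) :
    ∑ rs ∈ Finset.HasAntidiagonal.antidiagonal M,
      ((mul rs.1 x (mul rs.2 y z)).tensor + (mul rs.1 y (mul rs.2 z x)).tensor +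
        (mul rs.1 z (mul rs.2 x y)).tensor) = 0 := by
  have h1 := sum_multiIdx_two M fun m => (mul (m 0) x (mul (m 1) y z)).tensor +
    (mul (m 0) y (mul (m 1) z x)).tensor + (mul (m 0) z (mul (m 1) x y)).tensor
  refine h1.symm.trans ?_
  have hsum : ∀ m ∈ multiIdx 2 M, ∑ i, m i = M := fun m hm => (Finset.mem_piAntidiag.1 hm).1
  -- One cyclic rotation brings this term to the operators $T_{abc}$, and two bring the third term
  -- there. The coefficients are then exactly those of the reduced Jacobi identity.
  have hy : ∑ m ∈ multiIdx 2 M, (mul (m 0) y (mul (m 1) z x)).tensor =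
      ∑ m ∈ multiIdx 2 M, (∑ m' ∈ multiIdx 2 M, Y ![x.dim, y.dim, z.dim] m' m •
        L.Γ (m' 0) y.vec (L.Γ (m' 1) z.vec x.vec)) ⊗ₜ[𝕜] (mul (m 0) x (mul (m 1) y z)).fn := by
    simp only [sum_tmul]
    rw [Finset.sum_comm]
    refine Finset.sum_congr rfl fun m' hm' => ?_
    rw [tensor, cyclic_expansion hL x y z m', hsum m' hm']
    · rfl
    · exact mul_mul_mem y z x m' (by ring)
    · rintro (h | h | h) <;> simp [mul, h]
  have hz : ∑ m ∈ multiIdx 2 M, (mul (m 0) z (mul (m 1) x y)).tensor =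
      ∑ m ∈ multiIdx 2 M, (∑ m'' ∈ multiIdx 2 M,
        (∑ m' ∈ multiIdx 2 M, Y ![y.dim, z.dim, x.dim] m'' m' * Y ![x.dim, y.dim, z.dim] m' m) •
        L.Γ (m'' 0) z.vec (L.Γ (m'' 1) x.vec y.vec)) ⊗ₜ[𝕜] (mul (m 0) x (mul (m 1) y z)).fn := by
    simp only [sum_tmul, Finset.sum_smul]
    rw [Finset.sum_comm]
    refine Finset.sum_congr rfl fun m'' hm'' => ?_
    rw [tensor, cyclic_expansion hL y z x m'' _ ?_ (by rintro (h | h | h) <;> simp [mul, h]),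
      hsum m'' hm'', Finset.sum_comm]
    · refine Finset.sum_congr rfl fun m' hm' => ?_
      rw [cyclic_expansion hL x y z m', hsum m' hm']
      · refine Finset.sum_congr rfl fun m _ => ?_
        rw [smul_smul, mul_comm]
        rfl
      · refine Submodule.smul_mem _ _ ?_
        exact mul_mul_mem z x y m'' (by rw [hsum m' hm', hsum m'' hm'']; ring)
      · rintro (h | h | h) <;> simp [mul, h]
    · exact mul_mul_mem z x y m'' (by ring)
  rw [Finset.sum_add_distrib, Finset.sum_add_distrib, hy, hz, ← Finset.sum_add_distrib,
    ← Finset.sum_add_distrib]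
  refine Finset.sum_eq_zero fun m hm => ?_
  have hJ := L.jacobi x.dim y.dim z.dim x.vec x.mem y.vec y.mem z.vec z.mem m
  rw [hsum m hm] at hJ
  rw [tensor, ← add_tmul, ← add_tmul]
  exact (congrArg (· ⊗ₜ[𝕜] (mul (m 0) x (mul (m 1) y z)).fn) hJ).trans (zero_tmul _ _)

end ReducedLieAlgebra

end RedLie

end

/-! ### Smeared cochains and the identities of their brackets -/

noncomputable section

namespace RedLie

namespace ReducedLieAlgebra

open TensorProduct SmearedVec

variable {𝕜 : Type*} [RCLike 𝕜] {V : Type*} [AddCommGroup V] [Module 𝕜 V]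

variable (𝕜 V) in
/-- The values of smeared cochains: an element of `V ⊗ C^∞(ℝ)` for every total index and every
scaling dimension. -/
abbrev SmearedOut : Type _ := ℕ → 𝕜 → V ⊗[𝕜] Smooth 𝕜

variable (𝕜 V) in
/-- The shift of the total index by `r`, truncated at `N`. -/
def shift (N r : ℕ) : SmearedOut 𝕜 V →ₗ[𝕜] SmearedOut 𝕜 V where
  toFun h M e := if r ≤ M ∧ M < N then h (M - r) e else 0
  map_add' h h' := by
    ext M e
    by_cases hM : r ≤ M ∧ M < N <;> simp [hM]
  map_smul' c h := by
    ext M e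
    by_cases hM : r ≤ M ∧ M < N <;> simp [hM]

theorem shift_apply (N r : ℕ) (h : SmearedOut 𝕜 V) (M : ℕ) (e : 𝕜) :
    shift 𝕜 V N r h M e = if r ≤ M ∧ M < N then h (M - r) e else 0 := rfl

variable {L : ReducedLieAlgebra 𝕜 V}

/-- The component of index `r` of the bracket with a smeared element. -/
def bracketLeft (r : ℕ) (x : L.SmearedVec) : SmearedOut 𝕜 V →ₗ[𝕜] SmearedOut 𝕜 V where
  toFun h M e := TensorProduct.map (L.Γ r x.vec) (lam x.dim (e - x.dim + 1 + r) r x.fn)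
    (h M (e - x.dim + 1 + r))
  map_add' h h' := by ext M e; simp
  map_smul' c h := by ext M e; simp

theorem bracketLeft_apply (r : ℕ) (x : L.SmearedVec) (h : SmearedOut 𝕜 V) (M : ℕ) (e : 𝕜) :
    bracketLeft r x h M e =
      TensorProduct.map (L.Γ r x.vec) (lam x.dim (e - x.dim + 1 + r) r x.fn)
        (h M (e - x.dim + 1 + r)) := rfl

variable (L) in
/-- The adjoint action on smeared values, truncated at total index `N`. -/
def action (N : ℕ) : FormalAction 𝕜 L.SmearedVec (SmearedOut 𝕜 V) where
  mul := SmearedVec.mul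
  Ad := bracketLeft
  S := shift 𝕜 V N
  N := N
  S_S r s h := by
    ext M e
    simp only [shift_apply, Nat.sub_sub]
    split_ifs <;> first | rfl | omega
  S_eq_zero r h hr := by
    ext M e
    rw [shift_apply, if_neg (by omega)]
    rfl
  S_Ad r s x h := by
    ext M e
    simp only [shift_apply, bracketLeft_apply]
    split_ifs <;> simp

theorem family_congr {n : ℕ} (u : L.Family n) {a a' : Fin n → 𝕜} (h : a = a')
    (m : Fin (n - 1) → ℕ) {x : (i : Fin n) → L.gr (a i)} {x' : (i : Fin n) → L.gr (a' i)}
    (hx : ∀ i, (x i : V) = x' i) : u a m x = u a' m x' := by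
  subst h
  exact congrArg (u a m) (funext fun i => Subtype.ext (hx i))

/-- Families that are multilinear in their arguments. -/
def IsMultilinear {n : ℕ} (u : L.Family n) : Prop :=
  ∀ a m, ∃ Φ : MultilinearMap 𝕜 (fun _ : Fin n => V) V, ∀ x, u a m x = Φ fun i => (x i : V)

/-- Families with values of the expected scaling dimension. -/
def IsGraded {n : ℕ} (u : L.Family n) : Prop :=
  ∀ a m x, u a m x ∈ L.gr (outDim a m)

theorem IsMultilinear.eq_zero {n : ℕ} {u : L.Family n} (hu : IsMultilinear u) (a : Fin n → 𝕜)
    (m : Fin (n - 1) → ℕ) (x : (i : Fin n) → L.gr (a i)) (h : ∃ i, L.gr (a i) = ⊥) :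
    u a m x = 0 := by
  obtain ⟨Φ, hΦ⟩ := hu a m
  obtain ⟨i, hi⟩ := h
  rw [hΦ]
  refine Φ.map_coord_zero i ?_
  exact (Submodule.mem_bot 𝕜).1 (hi.le (x i).2)

variable (L) in
/-- The smeared version of a multi-component function. -/
def smear (N : ℕ) {n : ℕ} :
    L.Family n →ₗ[𝕜] ((Fin n → L.SmearedVec) → SmearedOut 𝕜 V) where
  toFun u x M e := open Classical in
    if M < N ∧ e = ∑ i, (x i).dim - M - n + 1 then
      ∑ m ∈ multiIdx (n - 1) M, u (fun i => (x i).dim) m (fun i => ⟨(x i).vec, (x i).mem⟩) ⊗ₜ[𝕜]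
        defaultT n (fun i => (x i).dim) m (fun i => (x i).fn)
    else 0
  map_add' u u' := by
    ext x M e
    simp only [Pi.add_apply]
    split_ifs <;> simp [add_tmul, Finset.sum_add_distrib]
  map_smul' c u := by
    ext x M e
    simp only [Pi.smul_apply]
    split_ifs <;> simp [smul_tmul', Finset.smul_sum]

open Classical in
theorem smear_apply (N : ℕ) {n : ℕ} (u : L.Family n) (x : Fin n → L.SmearedVec) (M : ℕ) (e : 𝕜) :
    smear L N u x M e = if M < N ∧ e = ∑ i, (x i).dim - M - n + 1 then
      ∑ m ∈ multiIdx (n - 1) M, u (fun i => (x i).dim) m (fun i => ⟨(x i).vec, (x i).mem⟩) ⊗ₜ[𝕜]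
        defaultT n (fun i => (x i).dim) m (fun i => (x i).fn)
    else 0 := rfl

/-- Smeared vectors form no vector space. At a fixed dimension, however, the value depends linearly
on the tensor of the first argument, which lets linear identities between brackets pass through `u`.
-/
theorem exists_smear_cons (N : ℕ) {k : ℕ} {u : L.Family (k + 1)} (hu : IsMultilinear u)
    (y : Fin k → L.SmearedVec) (e : 𝕜) :
    ∃ Λ : V ⊗[𝕜] Smooth 𝕜 →ₗ[𝕜] SmearedOut 𝕜 V, ∀ p : L.SmearedVec, p.dim = e →
      smear L N u (Fin.cons (α := fun _ => L.SmearedVec) p y) = Λ p.tensor := by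
  classical
  let a : Fin (k + 1) → 𝕜 := Fin.cons e fun i => (y i).dim
  choose Φ hΦ using hu a
  let β : V →ₗ[𝕜] Smooth 𝕜 →ₗ[𝕜] SmearedOut 𝕜 V := LinearMap.mk₂ 𝕜
    (fun v f M e' => if M < N ∧ e' = ∑ i, a i - M - (k + 1 : ℕ) + 1 then
      ∑ m ∈ multiIdx (k + 1 - 1) M,
        Φ m (Fin.cons (α := fun _ => V) v fun i => (y i).vec) ⊗ₜ[𝕜]
          defaultT (k + 1) a m (Fin.cons (α := fun _ => Smooth 𝕜) f fun i => (y i).fn)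
      else 0)
    (fun v v' f => by
      ext M e'
      simp only [Pi.add_apply, MultilinearMap.cons_add]
      split_ifs <;> simp [add_tmul, Finset.sum_add_distrib])
    (fun c v f => by
      ext M e'
      simp only [Pi.smul_apply, MultilinearMap.cons_smul]
      split_ifs <;> simp [smul_tmul', Finset.smul_sum])
    (fun v f f' => by
      ext M e'
      simp only [Pi.add_apply, MultilinearMap.cons_add]
      split_ifs <;> simp [tmul_add, Finset.sum_add_distrib])
    (fun c v f => by
      ext M e'
      simp only [Pi.smul_apply, MultilinearMap.cons_smul]
      split_ifs <;> simp [Finset.smul_sum])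
  refine ⟨TensorProduct.lift β, fun p hp => ?_⟩
  have hd : (fun i => (Fin.cons (α := fun _ => L.SmearedVec) p y i).dim) = a := by
    funext i
    refine Fin.cases ?_ (fun i => ?_) i
    · exact hp
    · simp [a]
  have hv : ∀ i, (Fin.cons (α := fun _ => L.SmearedVec) p y i).vec =
      Fin.cons (α := fun _ => V) p.vec (fun i => (y i).vec) i := fun i => by
    refine Fin.cases ?_ (fun i => ?_) i <;> simp
  have hf : (fun i => (Fin.cons (α := fun _ => L.SmearedVec) p y i).fn) =
      Fin.cons (α := fun _ => Smooth 𝕜) p.fn (fun i => (y i).fn) := by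
    funext i
    refine Fin.cases ?_ (fun i => ?_) i <;> simp
  have hva : ∀ i, Fin.cons (α := fun _ => V) p.vec (fun i => (y i).vec) i ∈ L.gr (a i) :=
    fun i => by
      rw [← hv, ← hd]
      exact (Fin.cons (α := fun _ => L.SmearedVec) p y i).mem
  have hu' : ∀ m, u (fun i => (Fin.cons (α := fun _ => L.SmearedVec) p y i).dim) m
      (fun i => ⟨(Fin.cons (α := fun _ => L.SmearedVec) p y i).vec,
        (Fin.cons (α := fun _ => L.SmearedVec) p y i).mem⟩) =
      Φ m (Fin.cons (α := fun _ => V) p.vec fun i => (y i).vec) := fun m => by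
    rw [family_congr u hd m (x' := fun i => ⟨_, hva i⟩) hv, hΦ]
  ext M e'
  rw [smear_apply, tensor, TensorProduct.lift.tmul]
  simp only [hu', hf, hd]
  rfl

theorem headInner_swap (N : ℕ) {k : ℕ} {u : L.Family (k + 1)} (hu : IsMultilinear u) :
    permute 𝕜 (Equiv.swap 0 1) ((action L N).headInner (smear L N u)) =
      -(action L N).headInner (smear L N u) := by
  ext1 x
  rw [permute_apply, FormalAction.headInner_apply, Pi.neg_apply, FormalAction.headInner_apply,
    ← Finset.sum_neg_distrib]
  refine Finset.sum_congr rfl fun r _ => ?_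
  rw [← map_neg]
  congr 1
  have h : ∀ i : Fin k, Equiv.swap 0 1 i.succ.succ = i.succ.succ := fun i =>
    Equiv.swap_apply_of_ne_of_ne (Fin.succ_ne_zero _) (Fin.succ_succ_ne_one _)
  simp only [Function.comp_apply, Equiv.swap_apply_left, Equiv.swap_apply_right, h]
  obtain ⟨Λ, hΛ⟩ := exists_smear_cons N hu (fun i => x i.succ.succ) (mul r (x 0) (x 1)).dim
  have h1 := hΛ (mul r (x 1) (x 0)) (by simp only [mul]; ring)
  have h2 := hΛ (mul r (x 0) (x 1)) rfl
  refine h1.trans (Eq.trans ?_ (congrArg Neg.neg h2).symm)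
  rw [tensor_mul_symm, map_neg]

theorem headInner_jacobi (hL : L.HasDefaultBases) (N : ℕ) {k : ℕ} {u : L.Family (k + 1)}
    (hu : IsMultilinear u) :
    (action L N).headInner ((action L N).headInner (smear L N u)) +
      permute 𝕜 (Equiv.swap 0 1 * Equiv.swap 0 2)
        ((action L N).headInner ((action L N).headInner (smear L N u))) +
      permute 𝕜 (Equiv.swap 0 2 * Equiv.swap 0 1)
        ((action L N).headInner ((action L N).headInner (smear L N u))) = 0 := by
  have key : ∀ x : Fin (k + 3) → L.SmearedVec,
      (action L N).headInner ((action L N).headInner (smear L N u)) x =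
      ∑ r ∈ Finset.range N, ∑ s ∈ Finset.range N, (action L N).S r ((action L N).S s
        (smear L N u (Fin.cons (α := fun _ => L.SmearedVec) (mul s (mul r (x 0) (x 1)) (x 2))
          fun i => x i.succ.succ.succ))) := fun x => by
    rw [FormalAction.headInner_apply]
    refine Finset.sum_congr rfl fun r _ => ?_
    rw [FormalAction.headInner_apply, map_sum]
    rfl
  have e0 : (Equiv.swap 0 1 * Equiv.swap 0 2 : Equiv.Perm (Fin (k + 3))) 0 = 2 := by
    rw [Equiv.Perm.mul_apply, Equiv.swap_apply_left,
      Equiv.swap_apply_of_ne_of_ne zero_ne_two.symm one_ne_two.symm]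
  have e1 : (Equiv.swap 0 1 * Equiv.swap 0 2 : Equiv.Perm (Fin (k + 3))) 1 = 0 := by
    rw [Equiv.Perm.mul_apply, Equiv.swap_apply_of_ne_of_ne (by simp)
      one_ne_two, Equiv.swap_apply_right]
  have e2 : (Equiv.swap 0 1 * Equiv.swap 0 2 : Equiv.Perm (Fin (k + 3))) 2 = 1 := by
    rw [Equiv.Perm.mul_apply, Equiv.swap_apply_right, Equiv.swap_apply_left]
  have f0 : (Equiv.swap 0 2 * Equiv.swap 0 1 : Equiv.Perm (Fin (k + 3))) 0 = 1 := by
    rw [Equiv.Perm.mul_apply, Equiv.swap_apply_left,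
      Equiv.swap_apply_of_ne_of_ne (by simp) one_ne_two]
  have f1 : (Equiv.swap 0 2 * Equiv.swap 0 1 : Equiv.Perm (Fin (k + 3))) 1 = 2 := by
    rw [Equiv.Perm.mul_apply, Equiv.swap_apply_right, Equiv.swap_apply_left]
  have f2 : (Equiv.swap 0 2 * Equiv.swap 0 1 : Equiv.Perm (Fin (k + 3))) 2 = 0 := by
    rw [Equiv.Perm.mul_apply, Equiv.swap_apply_of_ne_of_ne zero_ne_two.symm one_ne_two.symm,
      Equiv.swap_apply_right]
  have h2 : ∀ i : Fin k, i.succ.succ.succ ≠ 2 := fun i h =>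
    Fin.succ_succ_ne_one i (Fin.succ_injective _ h)
  have e3 : ∀ i : Fin k, (Equiv.swap 0 1 * Equiv.swap 0 2 : Equiv.Perm (Fin (k + 3)))
      i.succ.succ.succ = i.succ.succ.succ := fun i => by
    rw [Equiv.Perm.mul_apply, Equiv.swap_apply_of_ne_of_ne (Fin.succ_ne_zero _) (h2 i),
      Equiv.swap_apply_of_ne_of_ne (Fin.succ_ne_zero _) (Fin.succ_succ_ne_one _)]
  have f3 : ∀ i : Fin k, (Equiv.swap 0 2 * Equiv.swap 0 1 : Equiv.Perm (Fin (k + 3)))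
      i.succ.succ.succ = i.succ.succ.succ := fun i => by
    rw [Equiv.Perm.mul_apply,
      Equiv.swap_apply_of_ne_of_ne (Fin.succ_ne_zero _) (Fin.succ_succ_ne_one _),
      Equiv.swap_apply_of_ne_of_ne (Fin.succ_ne_zero _) (h2 i)]
  ext1 x
  simp only [Pi.add_apply, permute_apply, key, Function.comp_apply, e0, e1, e2, e3, f0, f1, f2, f3,
    ← Finset.sum_add_distrib, ← map_add]
  refine (action L N).sum_S_S_eq_zero (fun r s => _) fun m => ?_
  -- All double brackets of total index `m` have this same dimension, so one linear map serves the
  -- whole antidiagonal.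
  obtain ⟨Λ, hΛ⟩ := exists_smear_cons N hu (fun i => x i.succ.succ.succ)
    ((x 0).dim + (x 1).dim + (x 2).dim - m - 2)
  have hd : ∀ (p q t : L.SmearedVec) (r s : ℕ), r + s = m →
      p.dim + q.dim + t.dim = (x 0).dim + (x 1).dim + (x 2).dim →
      smear L N u (Fin.cons (α := fun _ => L.SmearedVec) (mul s (mul r p q) t)
          fun i => x i.succ.succ.succ) = -Λ (mul s t (mul r p q)).tensor := fun p q t r s hr hp => by
    rw [hΛ, tensor_mul_symm, map_neg]
    rw [← hp, ← hr]
    simp only [mul]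
    push_cast
    ring
  have hJ := congrArg Λ (jacobi_tensor hL (x 0) (x 1) (x 2) m)
  rw [map_sum, map_zero, ← Finset.Nat.sum_antidiagonal_swap, ← neg_eq_zero,
    ← Finset.sum_neg_distrib] at hJ
  refine Eq.trans (Finset.sum_congr rfl fun rs hrs => ?_) hJ
  rw [Finset.HasAntidiagonal.mem_antidiagonal] at hrs
  rw [hd _ _ _ _ _ hrs rfl, hd _ _ _ _ _ hrs (by ring), hd _ _ _ _ _ hrs (by ring), map_add,
    map_add]
  simp only [Prod.fst_swap, Prod.snd_swap]
  abel

/-- By linearity the value of `w` may be taken to be a pure tensor with homogeneous first factor. It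
is then itself a smeared vector, and the Jacobi identity applies to it. -/
theorem outer_jacobi (hL : L.HasDefaultBases) (N : ℕ) {n : ℕ}
    (w : (Fin n → L.SmearedVec) → SmearedOut 𝕜 V)
    (hw : ∀ x M e, w x M e ∈ Submodule.span 𝕜 {t | ∃ v ∈ L.gr e, ∃ g, t = v ⊗ₜ[𝕜] g}) :
    (action L N).outer ((action L N).outer w) -
      permute 𝕜 (Equiv.swap 0 1) ((action L N).outer ((action L N).outer w)) =
      (action L N).headInner ((action L N).outer w) := by
  have key : ∀ x : Fin (n + 2) → L.SmearedVec, (action L N).outer ((action L N).outer w) x =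
      ∑ r ∈ Finset.range N, ∑ s ∈ Finset.range N, (action L N).S r ((action L N).S s
        (bracketLeft r (x 0) (bracketLeft s (x 1) (w fun i => x i.succ.succ)))) := fun x => by
    rw [FormalAction.outer_apply]
    refine Finset.sum_congr rfl fun r _ => ?_
    rw [FormalAction.outer_apply, map_sum, map_sum]
    refine Finset.sum_congr rfl fun s _ => ?_
    rw [← (action L N).S_Ad s r]
    rfl
  have key' : ∀ x : Fin (n + 2) → L.SmearedVec, (action L N).headInner ((action L N).outer w) x =
      ∑ r ∈ Finset.range N, ∑ s ∈ Finset.range N, (action L N).S r ((action L N).S s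
        (bracketLeft r (mul s (x 0) (x 1)) (w fun i => x i.succ.succ))) := fun x => by
    rw [FormalAction.headInner_apply, Finset.sum_comm]
    refine Finset.sum_congr rfl fun r _ => ?_
    rw [FormalAction.outer_apply, map_sum]
    refine Finset.sum_congr rfl fun s _ => ?_
    rw [(action L N).S_S, (action L N).S_S, add_comm]
    rfl
  have h : ∀ i : Fin n, Equiv.swap 0 1 i.succ.succ = i.succ.succ := fun i =>
    Equiv.swap_apply_of_ne_of_ne (Fin.succ_ne_zero _) (Fin.succ_succ_ne_one _)
  rw [← sub_eq_zero]
  ext1 x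
  simp only [Pi.sub_apply, permute_apply, key, key', Function.comp_apply, Equiv.swap_apply_left,
    Equiv.swap_apply_right, h, ← Finset.sum_sub_distrib, ← map_sub]
  refine (action L N).sum_S_S_eq_zero (fun r s => _) fun m => ?_
  ext M e
  rw [Finset.sum_apply, Finset.sum_apply]
  have hq := hw (fun i => x i.succ.succ) M (e - (x 0).dim - (x 1).dim + 2 + m)
  -- The dimension that two brackets of total index `m` with `x 0` and `x 1` carry to `e`.
  set e' := e - (x 0).dim - (x 1).dim + 2 + m with he'
  have hc : ∀ rs ∈ Finset.HasAntidiagonal.antidiagonal m,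
      (bracketLeft rs.1 (x 0) (bracketLeft rs.2 (x 1) (w fun i => x i.succ.succ)) -
        bracketLeft rs.1 (x 1) (bracketLeft rs.2 (x 0) (w fun i => x i.succ.succ)) -
        bracketLeft rs.1 (mul rs.2 (x 0) (x 1)) (w fun i => x i.succ.succ)) M e =
      (TensorProduct.map (L.Γ rs.1 (x 0).vec)
          (lam (x 0).dim ((x 1).dim + e' - 1 - rs.2) rs.1 (x 0).fn) ∘ₗ
        TensorProduct.map (L.Γ rs.2 (x 1).vec) (lam (x 1).dim e' rs.2 (x 1).fn) -
      TensorProduct.map (L.Γ rs.1 (x 1).vec)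
          (lam (x 1).dim ((x 0).dim + e' - 1 - rs.2) rs.1 (x 1).fn) ∘ₗ
        TensorProduct.map (L.Γ rs.2 (x 0).vec) (lam (x 0).dim e' rs.2 (x 0).fn) -
      TensorProduct.map (L.Γ rs.1 (mul rs.2 (x 0) (x 1)).vec)
        (lam (mul rs.2 (x 0) (x 1)).dim e' rs.1 (mul rs.2 (x 0) (x 1)).fn))
        (w (fun i => x i.succ.succ) M e') := fun rs hrs => by
    rw [Finset.HasAntidiagonal.mem_antidiagonal] at hrs
    have hm : (m : 𝕜) = rs.1 + rs.2 := by rw [← hrs]; push_cast; rfl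
    simp only [Pi.sub_apply, bracketLeft_apply, LinearMap.sub_apply, LinearMap.comp_apply]
    have h1 : e - (x 0).dim + 1 + rs.1 = (x 1).dim + e' - 1 - rs.2 := by rw [he', hm]; ring
    have h2 : e - (x 1).dim + 1 + rs.1 = (x 0).dim + e' - 1 - rs.2 := by rw [he', hm]; ring
    have h3 : (x 1).dim + e' - 1 - rs.2 - (x 1).dim + 1 + rs.2 = e' := by ring
    have h4 : (x 0).dim + e' - 1 - rs.2 - (x 0).dim + 1 + rs.2 = e' := by ring
    have h5 : e - (mul rs.2 (x 0) (x 1)).dim + 1 + rs.1 = e' := by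
      rw [he', hm]; simp only [mul]; ring
    rw [h1, h2, h3, h4, h5]
  rw [Finset.sum_congr rfl hc, ← LinearMap.sum_apply]
  generalize w (fun i => x i.succ.succ) M e' = q at hq
  clear hc
  induction hq using Submodule.span_induction with
  | zero => rw [map_zero]; rfl
  | add q q' _ _ hq hq' => rw [map_add, hq, hq']; simp
  | smul c q _ hq => rw [map_smul, hq]; simp
  | mem q hq =>
    obtain ⟨v, hv, g, rfl⟩ := hq
    have hJ := jacobi_tensor hL (x 0) (x 1) ⟨e', v, g, hv⟩ m
    refine Eq.trans ?_ hJ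
    rw [LinearMap.sum_apply]
    refine Finset.sum_congr rfl fun rs _ => ?_
    rw [mul_mul_comm_tensor rs.1 rs.2 (x 1), tensor_mul_symm rs.1 ⟨e', v, g, hv⟩, ← sub_eq_add_neg,
      ← sub_eq_add_neg]
    rfl

end ReducedLieAlgebra

end RedLie

end

/-! ### Smearing as an injective map of complexes, and the conclusion -/

noncomputable section

namespace RedLie

namespace ReducedLieAlgebra

open TensorProduct SmearedVec

variable {𝕜 : Type*} [RCLike 𝕜] {V : Type*} [AddCommGroup V] [Module 𝕜 V]
  {L : ReducedLieAlgebra 𝕜 V}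

theorem outDim_comp {n : ℕ} (a : Fin n → 𝕜) (σ : Equiv.Perm (Fin n)) (m : Fin (n - 1) → ℕ) :
    outDim (a ∘ σ) m = outDim a m := by
  rw [outDim, outDim, show ∑ i, (a ∘ σ) i = ∑ i, a i from Equiv.sum_comp σ a]

theorem outDim_eq {n : ℕ} (a : Fin n → 𝕜) (m : Fin (n - 1) → ℕ) :
    outDim a m = ∑ i, a i - (∑ i, m i : ℕ) - n + 1 := by
  rw [outDim, Nat.cast_sum]

variable (L) in
/-- The signed action of permutations on multi-component functions by the matrices `Z^ε`. -/
def permFamily {n : ℕ} (σ : Equiv.Perm (Fin n)) : L.Family n →ₗ[𝕜] L.Family n where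
  toFun u a m x := ∑ m' ∈ multiIdx (n - 1) (∑ i, m i),
    Zeps a σ m' m • u (a ∘ σ) m' (fun i => x (σ i))
  map_add' u u' := by
    ext a m x
    simp only [Pi.add_apply, smul_add, Finset.sum_add_distrib]
  map_smul' c u := by
    ext a m x
    simp only [Pi.smul_apply, smul_comm _ c, ← Finset.smul_sum, RingHom.id_apply]

theorem permFamily_apply {n : ℕ} (σ : Equiv.Perm (Fin n)) (u : L.Family n) (a : Fin n → 𝕜)
    (m : Fin (n - 1) → ℕ) (x : (i : Fin n) → L.gr (a i)) :
    permFamily L σ u a m x = ∑ m' ∈ multiIdx (n - 1) (∑ i, m i),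
      Zeps a σ m' m • u (a ∘ σ) m' (fun i => x (σ i)) := rfl

theorem IsMultilinear.add {n : ℕ} {u u' : L.Family n} (hu : IsMultilinear u)
    (hu' : IsMultilinear u') : IsMultilinear (u + u') := fun a m => by
  obtain ⟨Φ, hΦ⟩ := hu a m
  obtain ⟨Ψ, hΨ⟩ := hu' a m
  exact ⟨Φ + Ψ, fun x => by simp [hΦ, hΨ]⟩

theorem IsMultilinear.smul {n : ℕ} {u : L.Family n} (hu : IsMultilinear u) (c : 𝕜) :
    IsMultilinear (c • u) := fun a m => by
  obtain ⟨Φ, hΦ⟩ := hu a m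
  exact ⟨c • Φ, fun x => by simp [hΦ]⟩

theorem IsMultilinear.sum {n : ℕ} {ι : Type*} (s : Finset ι) {u : ι → L.Family n}
    (hu : ∀ i, IsMultilinear (u i)) : IsMultilinear (∑ i ∈ s, u i) := by
  classical
  induction s using Finset.induction_on with
  | empty => exact fun a m => ⟨0, fun x => by simp⟩
  | insert i s hi ih => rw [Finset.sum_insert hi]; exact (hu i).add ih

theorem IsMultilinear.permFamily {n : ℕ} {u : L.Family n} (hu : IsMultilinear u)
    (σ : Equiv.Perm (Fin n)) : IsMultilinear (permFamily L σ u) := fun a m => by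
  choose Φ hΦ using hu (a ∘ σ)
  refine ⟨∑ m' ∈ multiIdx (n - 1) (∑ i, m i), Zeps a σ m' m • (Φ m').domDomCongr σ, fun x => ?_⟩
  rw [permFamily_apply, sum_apply]
  exact Finset.sum_congr rfl fun m' _ => by rw [hΦ]; rfl

theorem IsGraded.add {n : ℕ} {u u' : L.Family n} (hu : IsGraded u) (hu' : IsGraded u') :
    IsGraded (u + u') := fun a m x => add_mem (hu a m x) (hu' a m x)

theorem IsGraded.smul {n : ℕ} {u : L.Family n} (hu : IsGraded u) (c : 𝕜) :
    IsGraded (c • u) := fun a m x => Submodule.smul_mem _ c (hu a m x)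

theorem IsGraded.sum {n : ℕ} {ι : Type*} (s : Finset ι) {u : ι → L.Family n}
    (hu : ∀ i, IsGraded (u i)) : IsGraded (∑ i ∈ s, u i) := fun a m x => by
  simp only [Finset.sum_apply]
  exact Submodule.sum_mem _ fun i _ => hu i a m x

theorem IsGraded.permFamily {n : ℕ} {u : L.Family n} (hu : IsGraded u)
    (σ : Equiv.Perm (Fin n)) : IsGraded (permFamily L σ u) := fun a m x => by
  refine Submodule.sum_mem _ fun m' hm' => Submodule.smul_mem _ _ ?_
  have h := hu (a ∘ σ) m' fun i => x (σ i)
  rwa [outDim_comp, outDim_eq, (Finset.mem_piAntidiag.1 hm').1, ← outDim_eq] at h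

theorem mem_C_iff {n : ℕ} {w : L.Family n} :
    w ∈ L.C n ↔ IsMultilinear w ∧ IsGraded w ∧ ∀ σ, w = permFamily L σ w := by
  constructor
  · rintro ⟨h1, h2, h3⟩
    refine ⟨fun a m => ?_, h2, fun σ => ?_⟩
    · obtain ⟨φ, hφ⟩ := h1 a m
      -- Projections onto the graded pieces extend the multilinear map to all of $V$, which removes
      -- the dependence of its domain on `a`.
      have hp : ∀ i, ∃ p : V →ₗ[𝕜] L.gr (a i), p ∘ₗ (L.gr (a i)).subtype = LinearMap.id := fun i =>
        (L.gr (a i)).subtype.exists_leftInverse_of_injective (by simp)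
      choose p hp using hp
      refine ⟨φ.compLinearMap p, fun x => ?_⟩
      rw [← hφ, MultilinearMap.compLinearMap_apply]
      exact congrArg φ (funext fun i => (LinearMap.congr_fun (hp i) (x i)).symm)
    · funext a m x
      exact h3 a m x σ
  · rintro ⟨h1, h2, h3⟩
    refine ⟨fun a m => ?_, h2, fun a m x σ => congrFun (congrFun (congrFun (h3 σ) a) m) x⟩
    obtain ⟨Φ, hΦ⟩ := h1 a m
    exact ⟨Φ.compLinearMap fun i => (L.gr (a i)).subtype, funext fun x => (hΦ x).symm⟩

theorem smear_permFamily (hL : L.HasDefaultBases) (N : ℕ) {n : ℕ} (hn : 1 ≤ n) {u : L.Family n}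
    (hu : IsMultilinear u) (hu' : IsGraded u) (σ : Equiv.Perm (Fin n)) :
    smear L N (permFamily L σ u) = sgn 𝕜 σ • permute 𝕜 σ (smear L N u) := by
  ext x M e
  have hs : ∑ i, ((x ∘ σ) i).dim = ∑ i, (x i).dim := Equiv.sum_comp σ fun i => (x i).dim
  simp only [Pi.smul_apply, permute_apply, smear_apply, hs]
  split_ifs with h
  swap
  · simp
  have hM : ∀ m ∈ multiIdx (n - 1) M, ∑ i, m i = M := fun m hm => (Finset.mem_piAntidiag.1 hm).1
  rw [Finset.smul_sum]
  have hexp : ∀ m' ∈ multiIdx (n - 1) M,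
      u (fun i => ((x ∘ σ) i).dim) m' (fun i => ⟨((x ∘ σ) i).vec, ((x ∘ σ) i).mem⟩) ⊗ₜ[𝕜]
        defaultT n (fun i => ((x ∘ σ) i).dim) m' (fun i => ((x ∘ σ) i).fn) =
      ∑ m ∈ multiIdx (n - 1) M, (Z (fun i => (x i).dim) σ m' m • u (fun i => ((x ∘ σ) i).dim) m'
        (fun i => ⟨((x ∘ σ) i).vec, ((x ∘ σ) i).mem⟩)) ⊗ₜ[𝕜]
        defaultT n (fun i => (x i).dim) m (fun i => (x i).fn) := fun m' hm' => by
    have h1 := tmul_expansion hL hn (fun i => (x i).dim) σ m'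
      (u (fun i => ((x ∘ σ) i).dim) m' (fun i => ⟨((x ∘ σ) i).vec, ((x ∘ σ) i).mem⟩))
      (by rw [← outDim_comp _ σ]; exact hu' _ _ _)
      (fun ⟨i, hi⟩ => hu.eq_zero _ _ _ ⟨σ.symm i, by simpa using hi⟩) fun i => (x i).fn
    rw [hM m' hm'] at h1
    exact h1
  rw [Finset.sum_congr rfl fun m' hm' => congrArg (sgn 𝕜 σ • ·) (hexp m' hm')]
  simp only [Finset.smul_sum]
  rw [Finset.sum_comm]
  refine Finset.sum_congr rfl fun m hm => ?_
  rw [permFamily_apply, hM m hm, sum_tmul]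
  refine Finset.sum_congr rfl fun m' _ => ?_
  rw [smul_tmul', smul_smul]
  rfl

theorem eq_zero_of_smear_eq_zero (hL : L.HasDefaultBases) {n : ℕ} (hn : 1 ≤ n) {u : L.Family n}
    (hu : IsMultilinear u) (hu' : IsGraded u) (h : ∀ N, smear L N u = 0) : u = 0 := by
  funext a m x
  by_cases ha : ∃ i, L.gr (a i) = ⊥
  · exact hu.eq_zero a m x ha
  by_cases he : L.gr (outDim a m) = ⊥
  · exact (Submodule.mem_bot 𝕜).1 (he.le (hu' a m x))
  rw [outDim_eq] at he
  refine (hasExpansion hL hn a _ (fun i hi => ha ⟨i, hi⟩) he).eq_zero (fun m => u a m x)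
    (fun f => ?_) m (by simp)
  -- This cutoff is the smallest one that keeps the total index of `m`.
  have h1 := congrFun (congrFun (congrFun (h (∑ i, m i + 1))
    fun i => ⟨a i, x i, f i, (x i).2⟩) (∑ i, m i)) (∑ i, a i - (∑ i, m i : ℕ) - n + 1)
  rw [smear_apply, if_pos ⟨Nat.lt_succ_self _, rfl⟩] at h1
  exact h1

theorem smear_isAntisymm (hL : L.HasDefaultBases) (N : ℕ) {n : ℕ} (hn : 1 ≤ n) {w : L.Family n}
    (hw : w ∈ L.C n) : IsAntisymm 𝕜 (smear L N w) := fun σ => by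
  obtain ⟨h1, h2, h3⟩ := mem_C_iff.1 hw
  have h := smear_permFamily hL N hn h1 h2 σ
  rw [← h3 σ] at h
  nth_rewrite 2 [h]
  rw [smul_smul, sgn_mul_self, one_smul]

/-- The difference of `u` and its transform under `σ` is again graded and multilinear, and it smears
to zero. -/
theorem mem_C_of_isAntisymm (hL : L.HasDefaultBases) {n : ℕ} (hn : 1 ≤ n) {u : L.Family n}
    (hu : IsMultilinear u) (hu' : IsGraded u) (h : ∀ N, IsAntisymm 𝕜 (smear L N u)) :
    u ∈ L.C n := by
  refine mem_C_iff.2 ⟨hu, hu', fun σ => ?_⟩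
  have h0 : u + (-1 : 𝕜) • permFamily L σ u = 0 :=
    eq_zero_of_smear_eq_zero hL hn (hu.add ((hu.permFamily σ).smul _))
      (hu'.add ((hu'.permFamily σ).smul _)) fun N => by
        rw [map_add, map_smul, smear_permFamily hL N hn hu hu', h N σ, smul_smul, smul_smul,
          mul_assoc, sgn_mul_self]
        module
  rw [neg_smul, one_smul, ← sub_eq_add_neg, sub_eq_zero] at h0
  exact h0

theorem smear_mem_span (N : ℕ) {n : ℕ} {u : L.Family n} (hu : IsGraded u)
    (x : Fin n → L.SmearedVec) (M : ℕ) (e : 𝕜) :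
    smear L N u x M e ∈ Submodule.span 𝕜 {t | ∃ v ∈ L.gr e, ∃ g, t = v ⊗ₜ[𝕜] g} := by
  rw [smear_apply]
  split_ifs with h
  · refine Submodule.sum_mem _ fun m hm => Submodule.subset_span ⟨_, ?_, _, rfl⟩
    have h1 := hu (fun i => (x i).dim) m (fun i => ⟨(x i).vec, (x i).mem⟩)
    rwa [outDim_eq, (Finset.mem_piAntidiag.1 hm).1, ← h.2] at h1
  · exact zero_mem _

theorem sum_shift_apply (N : ℕ) (h : ℕ → SmearedOut 𝕜 V) (M : ℕ) (e : 𝕜) :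
    (∑ r ∈ Finset.range N, shift 𝕜 V N r (h r)) M e =
      if M < N then ∑ r ∈ Finset.range (M + 1), h r (M - r) e else 0 := by
  rw [Finset.sum_apply, Finset.sum_apply]
  simp only [shift_apply]
  split_ifs with hM
  · rw [← Finset.sum_filter]
    refine Finset.sum_congr ?_ fun _ _ => rfl
    ext r
    simp only [Finset.mem_filter, Finset.mem_range]
    omega
  · exact Finset.sum_eq_zero fun r _ => if_neg fun h => hM h.2

theorem smear_outerTerm (N : ℕ) {k : ℕ} (w : L.Family (k + 1)) :
    smear L N (n := k + 2) (L.outerTerm w) = (action L N).outer (smear L N w) := by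
  ext x M e
  rw [FormalAction.outer_apply]
  refine Eq.trans ?_ (sum_shift_apply N
    (fun r => bracketLeft r (x 0) (smear L N w fun i => x i.succ)) M e).symm
  simp only [smear_apply, bracketLeft_apply]
  by_cases hM : M < N
  swap
  · simp [hM]
  by_cases he : e = ∑ i, (x i).dim - M - (k + 2 : ℕ) + 1
  · rw [if_pos ⟨hM, he⟩, if_pos hM]
    refine (sum_multiIdx_cons k M _).trans (Finset.sum_congr rfl fun r hr => ?_)
    have hr' : r ≤ M := Nat.lt_succ_iff.1 (Finset.mem_range.1 hr)
    have he' : e - (x 0).dim + 1 + r = ∑ i : Fin (k + 1), (x i.succ).dim - (M - r : ℕ) -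
        (k + 1 : ℕ) + 1 := by
      rw [he, Fin.sum_univ_succ, Nat.cast_sub hr']
      push_cast
      ring
    rw [if_pos ⟨by omega, he'⟩, map_sum]
    refine Finset.sum_congr rfl fun m hm => ?_
    rw [TensorProduct.map_tmul, defaultT_succ]
    have hd : outDim (n := k + 1) (Fin.tail fun i => (x i).dim)
        (Fin.tail (n := k) (α := fun _ => ℕ) (Fin.cons r m)) = e - (x 0).dim + 1 + r := by
      rw [he', outDim_eq]
      have : ∑ i, Fin.tail (n := k) (Fin.cons (α := fun _ => ℕ) r m) i = M - r :=
        (Finset.mem_piAntidiag.1 hm).1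
      have h2 : (∑ i : Fin (k + 1 - 1), Fin.tail (n := k) (Fin.cons (α := fun _ => ℕ) r m) i) =
        M - r := this
      rw [h2]
      rfl
    rw [hd]
    rfl
  · rw [if_neg fun h => he h.2, if_pos hM]
    symm
    refine Finset.sum_eq_zero fun r hr => ?_
    have hr' : r ≤ M := Nat.lt_succ_iff.1 (Finset.mem_range.1 hr)
    rw [if_neg, map_zero]
    rintro ⟨-, h⟩
    refine he ?_
    rw [Nat.cast_sub hr'] at h
    rw [Fin.sum_univ_succ]
    push_cast at h ⊢
    linear_combination h

theorem smear_innerTerm (N : ℕ) {k : ℕ} (w : L.Family (k + 1)) :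
    smear L N (n := k + 2) (L.innerTerm w) = (action L N).inner (smear L N w) := by
  ext x M e
  rw [FormalAction.inner_apply]
  refine Eq.trans ?_ (sum_shift_apply N
    (fun r => smear L N w (Fin.snoc (α := fun _ => L.SmearedVec)
      (fun i : Fin k => x i.castSucc.castSucc)
      (mul r (x (Fin.last k).castSucc) (x (Fin.last (k + 1)))))) M e).symm
  simp only [smear_apply]
  by_cases hM : M < N
  swap
  · simp [hM]
  rw [if_pos hM]
  have hd : ∀ r, (fun i => (Fin.snoc (α := fun _ => L.SmearedVec)
      (fun i : Fin k => x i.castSucc.castSucc)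
      (mul r (x (Fin.last k).castSucc) (x (Fin.last (k + 1)))) i).dim) =
      mergeDim (fun i => (x i).dim) r := fun r => by
    funext i
    refine Fin.lastCases ?_ (fun i => ?_) i <;> simp [mergeDim, mul]
  have hsum : ∀ r ≤ M, ∑ i, mergeDim (fun i => (x i).dim) r i - (M - r : ℕ) - (k + 1 : ℕ) + 1 =
      ∑ i, (x i).dim - M - (k + 2 : ℕ) + 1 := fun r hr => by
    rw [Nat.cast_sub hr, Fin.sum_univ_castSucc, Fin.sum_univ_castSucc (n := k + 1),
      Fin.sum_univ_castSucc]
    simp only [mergeDim, Fin.snoc_castSucc, Fin.snoc_last]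
    push_cast
    ring
  by_cases he : e = ∑ i, (x i).dim - M - (k + 2 : ℕ) + 1
  · rw [if_pos ⟨hM, he⟩]
    refine (sum_multiIdx_snoc k M _).trans (Finset.sum_congr rfl fun r hr => ?_)
    have hr' : r ≤ M := Nat.lt_succ_iff.1 (Finset.mem_range.1 hr)
    rw [if_pos ⟨by omega, by rw [congrArg (fun f : Fin (k + 1) → 𝕜 => ∑ i, f i) (hd r),
      hsum r hr', he]⟩]
    refine Finset.sum_congr rfl fun m hm => ?_
    have hl : Fin.snoc (α := fun _ => ℕ) m r (Fin.last k) = r := Fin.snoc_last ..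
    have hi : Fin.init (n := k) (α := fun _ => ℕ) (Fin.snoc (α := fun _ => ℕ) m r) = m :=
      Fin.init_snoc ..
    generalize (Fin.snoc (α := fun _ => ℕ) m r : Fin (k + 1) → ℕ) = m' at hl hi
    subst hl hi
    refine congrArg₂ (· ⊗ₜ[𝕜] ·) (family_congr w (hd _).symm _ fun i => ?_) ?_
    · refine Fin.lastCases ?_ (fun i => ?_) i <;> simp [mergeArg, mul]
    · rw [defaultT_mergeDim, hd]
      congr 1
      funext i
      refine Fin.lastCases ?_ (fun i => ?_) i <;> simp [mul]
  · rw [if_neg fun h => he h.2]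
    symm
    refine Finset.sum_eq_zero fun r hr => ?_
    have hr' : r ≤ M := Nat.lt_succ_iff.1 (Finset.mem_range.1 hr)
    refine if_neg fun h => he ?_
    rw [h.2, congrArg (fun f : Fin (k + 1) → 𝕜 => ∑ i, f i) (hd r), hsum r hr']

theorem IsGraded.outerTerm {k : ℕ} {w : L.Family (k + 1)} (hw : IsGraded w) :
    IsGraded (n := k + 2) (L.outerTerm w) := fun a m x => by
  rw [outDim_cons]
  exact L.Γ_mem _ _ _ _ (x 0).2 _ (hw _ _ _)

theorem IsGraded.innerTerm {k : ℕ} {w : L.Family (k + 1)} (hw : IsGraded w) :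
    IsGraded (n := k + 2) (L.innerTerm w) := fun a m x => by
  rw [← outDim_mergeDim]
  exact hw _ _ _

theorem IsMultilinear.outerTerm {k : ℕ} {w : L.Family (k + 1)} (hw : IsMultilinear w) :
    IsMultilinear (n := k + 2) (L.outerTerm w) := fun a m => by
  obtain ⟨Φ, hΦ⟩ := hw (Fin.tail a) (Fin.tail (n := k) m)
  refine ⟨LinearMap.uncurryLeft
    { toFun := fun v => (L.Γ (m (0 : Fin (k + 1))) v).compMultilinearMap Φ
      map_add' := fun v v' => by ext; simp
      map_smul' := fun c v => by ext; simp }, fun x => ?_⟩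
  exact congrArg (L.Γ (m (0 : Fin (k + 1))) (x 0)) (hΦ fun i => x i.succ)

theorem IsMultilinear.innerTerm {k : ℕ} {w : L.Family (k + 1)} (hw : IsMultilinear w) :
    IsMultilinear (n := k + 2) (L.innerTerm w) := fun a m => by
  obtain ⟨Φ, hΦ⟩ := hw (mergeDim a (m (Fin.last k))) (Fin.init (n := k) m)
  let ψ : (V →ₗ[𝕜] V) →ₗ[𝕜] (V →ₗ[𝕜] V →ₗ[𝕜] V) :=
    { toFun := fun ℓ => (L.Γ (m (Fin.last k))).compr₂ ℓ
      map_add' := fun ℓ ℓ' => by ext; simp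
      map_smul' := fun c ℓ => by ext; simp }
  refine ⟨MultilinearMap.uncurryRight (M := fun _ : Fin (k + 2) => V)
    (MultilinearMap.uncurryRight (M := fun _ : Fin (k + 1) => V)
      (ψ.compMultilinearMap Φ.curryRight)), fun x => ?_⟩
  rw [ReducedLieAlgebra.innerTerm, hΦ]
  rfl

theorem b_succ (k : ℕ) (w : L.Family (k + 1)) :
    L.b (k + 1) w = ((-1 : 𝕜) ^ (k + 1) / ((k + 1).factorial : 𝕜)) •
      ∑ σ : Equiv.Perm (Fin (k + 2)), permFamily L σ (L.outerTerm w) +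
      (1 / (2 * (k.factorial : 𝕜))) •
        ∑ σ : Equiv.Perm (Fin (k + 2)), permFamily L σ (L.innerTerm w) := by
  funext a m x
  simp only [Pi.add_apply, Pi.smul_apply, Finset.sum_apply]
  rfl

theorem IsMultilinear.b {n : ℕ} {w : L.Family n} (hw : IsMultilinear w) :
    IsMultilinear (L.b n w) := by
  cases n with
  | zero =>
    exact fun a m => ⟨MultilinearMap.ofSubsingleton 𝕜 V V (0 : Fin 1)
      ((L.Γ 0).flip (w Fin.elim0 Fin.elim0 fun i => i.elim0)), fun x => rfl⟩
  | succ k =>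
    rw [b_succ]
    exact ((IsMultilinear.sum _ fun σ => hw.outerTerm.permFamily σ).smul _).add
      ((IsMultilinear.sum _ fun σ => hw.innerTerm.permFamily σ).smul _)

theorem IsGraded.b {n : ℕ} {w : L.Family n} (hw : IsGraded w) : IsGraded (L.b n w) := by
  cases n with
  | zero =>
    intro a m x
    have h := L.Γ_mem 0 _ _ _ (x 0).2 _ (hw Fin.elim0 Fin.elim0 fun i => i.elim0)
    have he : a 0 + outDim (n := 0) Fin.elim0 Fin.elim0 - 1 - ((0 : ℕ) : 𝕜) = outDim a m := by
      simp [outDim]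
    rw [he] at h
    exact h
  | succ k =>
    rw [b_succ]
    exact ((IsGraded.sum _ fun σ => hw.outerTerm.permFamily σ).smul _).add
      ((IsGraded.sum _ fun σ => hw.innerTerm.permFamily σ).smul _)

theorem smear_b_succ (hL : L.HasDefaultBases) (N : ℕ) {k : ℕ} {w : L.Family (k + 1)}
    (hw : IsMultilinear w) (hw' : IsGraded w) :
    smear L N (L.b (k + 1) w) = (action L N).diff k (smear L N w) := by
  rw [b_succ, map_add, map_smul, map_smul, map_sum, map_sum, FormalAction.diff, antisymm_eq,
    antisymm_eq]
  simp only [smear_permFamily hL N (Nat.succ_pos _) hw.outerTerm hw'.outerTerm,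
    smear_permFamily hL N (Nat.succ_pos _) hw.innerTerm hw'.innerTerm, smear_outerTerm,
    smear_innerTerm]

theorem sum_multiIdx_zero {E : Type*} [AddCommMonoid E] (M : ℕ) (F : (Fin 0 → ℕ) → E) :
    ∑ m ∈ multiIdx 0 M, F m = if M = 0 then F Fin.elim0 else 0 := by
  rw [multiIdx, Finset.univ_eq_empty, Finset.piAntidiag_empty]
  split_ifs
  · rw [Finset.sum_singleton]
    exact congrArg F (Subsingleton.elim _ _)
  · rfl

theorem smear_b_zero (N : ℕ) (w : L.Family 0) :
    smear L N (L.b 0 w) = (action L N).outer (smear L N w) := by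
  ext x M e
  rw [FormalAction.outer_apply]
  refine Eq.trans ?_ (sum_shift_apply N
    (fun r => bracketLeft r (x 0) (smear L N w fun i => x i.succ)) M e).symm
  have hL : smear L N (L.b 0 w) x M e = if M < N ∧ e = ∑ i, (x i).dim - M - (0 + 1 : ℕ) + 1 then
      if M = 0 then L.Γ 0 (x 0).vec (w Fin.elim0 Fin.elim0 fun i => i.elim0) ⊗ₜ[𝕜] (x 0).fn else 0
      else 0 := by
    rw [smear_apply]
    exact if_congr Iff.rfl (sum_multiIdx_zero M _) rfl
  have hR : ∀ r, bracketLeft r (x 0) (smear L N w fun i => x i.succ) (M - r) e =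
      if M - r < N ∧ e - (x 0).dim + 1 + r = 1 - (M - r : ℕ) then
        if M - r = 0 then L.Γ r (x 0).vec (w Fin.elim0 Fin.elim0 fun i => i.elim0) ⊗ₜ[𝕜]
          lam (x 0).dim (e - (x 0).dim + 1 + r) r (x 0).fn 1 else 0
      else 0 := fun r => by
    rw [bracketLeft_apply, smear_apply]
    have h1 : ∑ i : Fin 0, (x i.succ).dim - (M - r : ℕ) - (0 : ℕ) + 1 = 1 - (M - r : ℕ) := by
      simp [sub_eq_neg_add]
    have h2 := sum_multiIdx_zero (M - r) fun m => w (fun i => (x i.succ).dim) m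
      (fun i => ⟨(x i.succ).vec, (x i.succ).mem⟩) ⊗ₜ[𝕜]
        defaultT 0 (fun i => (x i.succ).dim) m (fun i => (x i.succ).fn)
    rw [h1]
    split_ifs with h h'
    · refine (congrArg _ (h2.trans (if_pos h'))).trans ?_
      rw [TensorProduct.map_tmul, family_congr w (a' := Fin.elim0) (Subsingleton.elim _ _) _
        (x' := fun i => i.elim0) fun i => i.elim0]
      rfl
    · exact (congrArg _ (h2.trans (if_neg h'))).trans (map_zero _)
    · exact map_zero _
  rw [hL]
  simp only [hR]
  -- A $0$-cochain has only the total index $0$, so only $r=M$ contributes; then `lam_one` leaves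
  -- only $M=0$.
  rw [Finset.sum_eq_single M]
  · have h1 : (e = ∑ i, (x i).dim - M - (0 + 1 : ℕ) + 1) ↔ (e - (x 0).dim + 1 + M = 1) := by
      simp only [Fin.sum_univ_succ, Fin.sum_univ_zero]
      push_cast
      constructor <;> intro h <;> linear_combination h
    by_cases hM : M < N
    swap
    · simp [hM]
    by_cases he : e - (x 0).dim + 1 + M = 1
    · have h0 : 0 < N := by omega
      simp only [hM, h1, he, h0, true_and, if_true, Nat.sub_self, Nat.cast_zero, sub_zero, lam_one]
      rcases Nat.eq_zero_or_pos M with rfl | hM0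
      · simp
      · simp [hM0.ne']
    · simp only [h1, he, and_false, if_false, Nat.sub_self, Nat.cast_zero, sub_zero, ite_self]
  · intro r hr hne
    rw [if_neg (c := M - r = 0) (by rw [Finset.mem_range] at hr; omega), ite_self]
  · intro h
    exact absurd (Finset.self_mem_range_succ M) h

theorem b_mem_C (hL : L.HasDefaultBases) {n : ℕ} {w : L.Family n} (hw : w ∈ L.C n) :
    L.b n w ∈ L.C (n + 1) := by
  obtain ⟨h1, h2, h3⟩ := mem_C_iff.1 hw
  refine mem_C_of_isAntisymm hL (Nat.succ_pos n) h1.b h2.b fun N => ?_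
  cases n with
  | zero =>
    intro σ
    rw [show σ = 1 from Equiv.ext fun i => Subsingleton.elim (α := Fin 1) _ _, sgn_one, one_smul]
    rfl
  | succ k =>
    rw [smear_b_succ hL N h1 h2]
    exact (action L N).isAntisymm_diff _

theorem b_b (hL : L.HasDefaultBases) {n : ℕ} {w : L.Family n} (hw : w ∈ L.C n) :
    L.b (n + 1) (L.b n w) = 0 := by
  obtain ⟨h1, h2, h3⟩ := mem_C_iff.1 hw
  refine eq_zero_of_smear_eq_zero hL (Nat.succ_pos _) h1.b.b h2.b.b fun N => ?_
  rw [smear_b_succ hL N h1.b h2.b]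
  have hJ := outer_jacobi hL N (smear L N w) (smear_mem_span N h2)
  cases n with
  | zero => rw [smear_b_zero, FormalAction.diff_outer _ hJ]
  | succ k =>
    rw [smear_b_succ hL N h1 h2]
    exact (action L N).diff_diff (smear_isAntisymm hL N (Nat.succ_pos k) hw)
      (headInner_swap N h1) hJ (headInner_jacobi hL N h1)

end ReducedLieAlgebra

end RedLie

end

theorem mainTheorem2 {𝕜 : Type*} [RCLike 𝕜] {V : Type*} [AddCommGroup V] [Module 𝕜 V]
    (L : RedLie.ReducedLieAlgebra 𝕜 V) (hL : L.HasDefaultBases) :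
    (∀ n, ∀ w ∈ L.C n, L.b n w ∈ L.C (n + 1)) ∧
    (∀ n, ∀ w ∈ L.C n, L.b (n + 1) (L.b n w) = 0) ∧
    (∀ n, L.coboundaries n ≤ L.cocycles n) ∧
    (∀ n, (LinearMap.ker (RedLie.ReducedLieAlgebra.RLH.mk L n)).map (L.cocycles n).subtype =
      L.coboundaries n) := by
  have h1 : ∀ n, ∀ w ∈ L.C n, L.b n w ∈ L.C (n + 1) := fun n w hw =>
    RedLie.ReducedLieAlgebra.b_mem_C hL hw
  have h2 : ∀ n, ∀ w ∈ L.C n, L.b (n + 1) (L.b n w) = 0 := fun n w hw =>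
    RedLie.ReducedLieAlgebra.b_b hL hw
  have h3 : ∀ n, L.coboundaries n ≤ L.cocycles n := by
    rintro (_ | n)
    · exact bot_le
    · rintro _ ⟨w, hw, rfl⟩
      exact ⟨h1 n w hw, h2 n w hw⟩
  refine ⟨h1, h2, h3, fun n => ?_⟩
  -- The quotient is formed by $B^n\cap Z^n$; the inclusion just proved makes this all of $B^n$.
  rw [RedLie.ReducedLieAlgebra.RLH.mk, Submodule.ker_mkQ, Submodule.submoduleOf,
    Submodule.map_comap_subtype, inf_eq_right]
  exact h3 n
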